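/- Let $\Omega\subset\mathbb{C}=\mathbb{R}^2$ be a simply connected domain with non-empty boundary, let $\varphi:\Omega\to\mathbb{D}$ be a conformal homeomorphism onto the open unit disc, with inverse $\varphi^{-1}:\mathbb{D}\to\Omega$, and let $h(z)=J_\varphi(z)=|\varphi'(z)|^2$ be its conformal weight. Let $\alpha_0\in(-2,0)$ and assume that the (inverse) Brennan conjecture holds on $[\alpha_0,2/3)$, that is, $\iint_{\mathbb{D}}|\psi'(u,v)|^{\alpha}\,du\,dv<\infty$ for every $\alpha\in[\alpha_0,2/3)$ and every conformal homeomorphism $\psi$ of $\mathbb{D}$ onto a planar domain. Let $$p\in\Big(\frac{|\alpha_0|+2}{|\alpha_0|+1},\,2\Big),\qquad 1\le r\le \frac{2p}{2-p}\cdot\frac{|\alpha_0|}{2+|\alpha_0|}.$$ For a domain $U\subset\mathbb{R}^2$ let $L^{1,s}(U)$ be the space of locally integrable, weakly differentiable functions $f:U\to\mathbb{R}$ with $\nabla f\in L^s(U)$, seminormed by $\|\nabla f\|_{L^s(U)}$, and let $W^{1,s}(U)=L^s(U)\cap L^{1,s}(U)$. Let $B_{r,p}(\Omega,h)\in[0,\infty]$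 be the best constant in the weighted Poincaré–Sobolev inequality $$\inf_{c\in\mathbb{R}}\Big(\iint_\Omega |f-c|^r h\,dx\,dy\Big)^{1/r}\le B_{r,p}(\Omega,h)\Big(\iint_\Omega|\nabla f|^p\,dx\,dy\Big)^{1/p},\qquad f\in W^{1,p}(\Omega),$$ let $B_{r,q}(\mathbb{D})\in[0,\infty]$ be the best constant in the corresponding non-weighted $(r,q)$-inequality on $\mathbb{D}$ for functions of $W^{1,q}(\mathbb{D})$, and let $K_{p,q}\in[0,\infty]$ be the norm of the composition operator $L^{1,p}(\Omega)\to L^{1,q}(\mathbb{D})$, $f\mapsto f\circ\varphi^{-1}$ (a best constant or norm is $\infty$ when no finite constant works). Then $B_{r,p}(\Omega,h)$ is finite, the weighted inequality above holds for every $f\in W^{1,p}(\Omega)$, and $$B_{r,p}(\Omega,h)\le \inf_{q\in[1,\,2p/(4-p))} K_{p,q}\cdot B_{r,q}(\mathbb{D})<\infty ,$$ where for every $q\in[1,2p/(4-p))$ $$K_{p,q}\le\Big(\iint_{\mathbb{D}}|(\varphi^{-1})'(u,v)|^{\frac{(p-2)q}{p-q}}\,du\,dv\Big)^{\frac{p-q}{pq}},$$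 the right-hand side being possibly infinite. -/

import Mathlib

open Set MeasureTheory
open scoped ENNReal ContDiff

/-- `G : ℂ → ℂ` is a weak gradient on the open set `Ω ⊆ ℂ = ℝ²` of the real function `f`
(the gradient vector `(∂ₓf, ∂ᵧf)` is written as the complex number `∂ₓf + i ∂ᵧf`, so that
`inner ℝ (G z) v` is the derivative in the direction `v` and `‖G z‖` is its Euclidean length). -/
def HasWeakGradientOn (Ω : Set ℂ) (f : ℂ → ℝ) (G : ℂ → ℂ) : Prop :=
  LocallyIntegrableOn f Ω ∧ LocallyIntegrableOn G Ω ∧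
    ∀ η : ℂ → ℝ, ContDiff ℝ ∞ η → HasCompactSupport η → tsupport η ⊆ Ω → ∀ v : ℂ,
      ∫ z in Ω, f z * fderiv ℝ η z v = - ∫ z in Ω, inner ℝ (G z) v * η z

/-- `f` belongs to the homogeneous Sobolev space `L^{1,p}(Ω)`, and `G` is its weak gradient. -/
def MemHomSobolev (p : ℝ) (Ω : Set ℂ) (f : ℂ → ℝ) (G : ℂ → ℂ) : Prop :=
  HasWeakGradientOn Ω f G ∧ MemLp G (ENNReal.ofReal p) (volume.restrict Ω)

/-- `f` belongs to the Sobolev space `W^{1,p}(Ω)`, and `G` is its weak gradient. -/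
def MemSobolev (p : ℝ) (Ω : Set ℂ) (f : ℂ → ℝ) (G : ℂ → ℂ) : Prop :=
  MemLp f (ENNReal.ofReal p) (volume.restrict Ω) ∧ MemHomSobolev p Ω f G

/-- The norm `‖G | L^p(Ω)‖ = (∫_Ω |G|^p)^{1/p}` of a vector field, with values in `[0, ∞]`. -/
noncomputable def gradNorm (p : ℝ) (Ω : Set ℂ) (G : ℂ → ℂ) : ℝ≥0∞ :=
  (∫⁻ z in Ω, ‖G z‖ₑ ^ p) ^ (1 / p)

/-- `inf_{c ∈ ℝ} (∫_Ω |f - c|^r h)^{1/r}`, with values in `[0, ∞]`. -/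
noncomputable def infDistConst (r : ℝ) (Ω : Set ℂ) (h : ℂ → ℝ) (f : ℂ → ℝ) : ℝ≥0∞ :=
  ⨅ c : ℝ, (∫⁻ z in Ω, ‖f z - c‖ₑ ^ r * ENNReal.ofReal (h z)) ^ (1 / r)

/-- The best constant `B_{r,p}(Ω, h) ∈ [0, ∞]` in the `(r, p)`-Poincaré–Sobolev inequality
on `Ω` with weight `h` (it is `∞` if the inequality holds with no finite constant). -/
noncomputable def poincareConst (r p : ℝ) (Ω : Set ℂ) (h : ℂ → ℝ) : ℝ≥0∞ :=
  sInf {C : ℝ≥0∞ | ∀ (f : ℂ → ℝ) (G : ℂ → ℂ), MemSobolev p Ω f G →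
    infDistConst r Ω h f ≤ C * gradNorm p Ω G}

/-- The norm in `[0, ∞]` of the composition operator `ψ^* : L^{1,p}(Ω) → L^{1,q}(Ω')`,
`f ↦ f ∘ ψ`, induced by `ψ : Ω' → Ω` (it is `∞` if `ψ` induces no bounded operator). -/
noncomputable def compositionNorm (p q : ℝ) (Ω Ω' : Set ℂ) (ψ : ℂ → ℂ) : ℝ≥0∞ :=
  sInf {K : ℝ≥0∞ | K < ⊤ ∧ ∀ (f : ℂ → ℝ) (G : ℂ → ℂ), MemHomSobolev p Ω f G →
    ∃ H : ℂ → ℂ, MemHomSobolev q Ω' (f ∘ ψ) H ∧ gradNorm q Ω' H ≤ K * gradNorm p Ω G}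

/-- The open unit disc. -/
def unitDisc : Set ℂ := Metric.ball 0 1

/-- `φ` is a conformal homeomorphism of `Ω` onto `Ω'`: a holomorphic bijection. -/
def IsConformalHomeo (Ω Ω' : Set ℂ) (φ : ℂ → ℂ) : Prop :=
  DifferentiableOn ℂ φ Ω ∧ BijOn φ Ω Ω'

/-- The conformal weight `J(z, φ) = |φ'(z)|²`. -/
noncomputable def conformalWeight (φ : ℂ → ℂ) (z : ℂ) : ℝ := ‖deriv φ z‖ ^ 2

/-- (Inverse) Brennan's conjecture holds for the interval `[α₀, 2/3)`: the derivative of any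
conformal mapping of the unit disc onto a planar domain belongs to `L^α` of the disc for every
`α ∈ [α₀, 2/3)`. -/
def BrennanConjectureOn (α₀ : ℝ) : Prop :=
  ∀ (ψ : ℂ → ℂ) (Ω : Set ℂ), IsConformalHomeo unitDisc Ω ψ → ∀ α ∈ Ico α₀ (2 / 3),
    ∫⁻ w in unitDisc, ‖deriv ψ w‖ₑ ^ α < ⊤

/-!
Write `ψ = φ⁻¹`. The change of variables `w = φ z` turns the weighted `L^r` norm on `Ω` into the
unweighted one on the disc, and the chain rule with Hölder's inequality bounds the gradient of
`f ∘ ψ` in `L^q` by that of `f` in `L^p`, up to an integral of `|ψ'| ^ ((p - 2) q / (p - q))`.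
Brennan's integrability of `|ψ'| ^ α₀` thus selects `q = |α₀| p / (2 + |α₀| - p)`, for which this
exponent is `α₀` and the critical Sobolev exponent `2 q / (2 - q)` is exactly the upper bound
for `r`.

The critical Sobolev inequality on the disc, including `q = 1`, starts from Gagliardo's `L¹`
argument, in polar coordinates near the boundary; the Poincaré inequality comes from averaging
along segments, and mollification passes from smooth to Sobolev functions.
-/

section ConformalHomeo

open Filter Function Topology

variable {Ω Ω' : Set ℂ} {φ : ℂ → ℂ}

namespace IsConformalHomeo

theorem differentiableAt (h : IsConformalHomeo Ω Ω' φ) (hΩ : IsOpen Ω) {z : ℂ} (hz : z ∈ Ω) :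
    DifferentiableAt ℂ φ z :=
  h.1.differentiableAt (hΩ.mem_nhds hz)

theorem nhds_le_map_nhds (h : IsConformalHomeo Ω Ω' φ) (hΩ : IsOpen Ω) {z : ℂ} (hz : z ∈ Ω) :
    𝓝 (φ z) ≤ map φ (𝓝 z) := by
  have han : AnalyticAt ℂ φ z := h.1.analyticAt (hΩ.mem_nhds hz)
  refine han.eventually_constant_or_nhds_le_map_nhds.resolve_left fun hconst => ?_
  obtain ⟨w, ⟨hw, hwΩ⟩, hwz⟩ := (((hconst.and (hΩ.mem_nhds hz)).filter_mono
    (nhdsWithin_le_nhds (s := {z}ᶜ))).and self_mem_nhdsWithin).exists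
  exact hwz (h.2.injOn hwΩ hz hw)

theorem isOpen_image (h : IsConformalHomeo Ω Ω' φ) (hΩ : IsOpen Ω) {U : Set ℂ} (hU : IsOpen U)
    (hUΩ : U ⊆ Ω) : IsOpen (φ '' U) := by
  rw [isOpen_iff_mem_nhds]
  rintro _ ⟨z, hz, rfl⟩
  exact h.nhds_le_map_nhds hΩ (hUΩ hz) (image_mem_map (hU.mem_nhds hz))

theorem isOpen_target (h : IsConformalHomeo Ω Ω' φ) (hΩ : IsOpen Ω) : IsOpen Ω' :=
  h.2.image_eq ▸ h.isOpen_image hΩ hΩ Subset.rfl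

theorem continuousAt_invFunOn (h : IsConformalHomeo Ω Ω' φ) (hΩ : IsOpen Ω) {z : ℂ}
    (hz : z ∈ Ω) : ContinuousAt (invFunOn φ Ω) (φ z) := by
  intro U hU
  rw [h.2.injOn.leftInvOn_invFunOn hz] at hU
  have himage : φ '' (U ∩ Ω) ∈ 𝓝 (φ z) :=
    h.nhds_le_map_nhds hΩ hz (image_mem_map (inter_mem hU (hΩ.mem_nhds hz)))
  refine mem_map.2 (mem_of_superset himage ?_)
  rintro _ ⟨w, ⟨hwU, hwΩ⟩, rfl⟩
  rwa [mem_preimage, h.2.injOn.leftInvOn_invFunOn hwΩ]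

theorem eventually_deriv_ne_zero (h : IsConformalHomeo Ω Ω' φ) (hΩ : IsOpen Ω) {z : ℂ}
    (hz : z ∈ Ω) : ∀ᶠ w in 𝓝[≠] z, deriv φ w ≠ 0 := by
  have han : AnalyticAt ℂ φ z := h.1.analyticAt (hΩ.mem_nhds hz)
  refine han.deriv.eventually_eq_zero_or_eventually_ne_zero.resolve_left fun hzero => ?_
  obtain ⟨ε, hε, hball⟩ := Metric.mem_nhds_iff.1 (hzero.and (hΩ.mem_nhds hz))
  have hconst : ∀ w ∈ Metric.ball z ε, φ w = φ z := fun w hw =>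
    Metric.isOpen_ball.is_const_of_deriv_eq_zero (convex_ball z ε).isPreconnected
      (h.1.mono fun x hx => (hball hx).2) (fun x hx => (hball hx).1) hw (Metric.mem_ball_self hε)
  obtain ⟨w, hw, hwz⟩ := Filter.nonempty_of_mem (inter_mem
    (nhdsWithin_le_nhds (Metric.ball_mem_nhds z hε)) (self_mem_nhdsWithin (s := {z}ᶜ)))
  exact hwz (h.2.injOn (hball hw).2 hz (hconst w hw))

theorem differentiableAt_invFunOn_of_deriv_ne_zero (h : IsConformalHomeo Ω Ω' φ)
    (hΩ : IsOpen Ω) {z : ℂ} (hz : z ∈ Ω) (hne : deriv φ z ≠ 0) :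
    DifferentiableAt ℂ (invFunOn φ Ω) (φ z) := by
  have hder : HasDerivAt φ (deriv φ z) (invFunOn φ Ω (φ z)) := by
    rw [h.2.injOn.leftInvOn_invFunOn hz]
    exact (h.differentiableAt hΩ hz).hasDerivAt
  refine (hder.of_local_left_inverse (h.continuousAt_invFunOn hΩ hz) hne ?_).differentiableAt
  filter_upwards [(h.isOpen_target hΩ).mem_nhds (h.2.mapsTo hz)] with w hw
  exact h.2.surjOn.rightInvOn_invFunOn hw

/- The zeros of `deriv φ` are isolated and the inverse is continuous, so the singularities which
they could cause are removable. -/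
theorem differentiableAt_invFunOn (h : IsConformalHomeo Ω Ω' φ) (hΩ : IsOpen Ω) {z : ℂ}
    (hz : z ∈ Ω) : DifferentiableAt ℂ (invFunOn φ Ω) (φ z) := by
  obtain ⟨ε, hε, hball⟩ := Metric.mem_nhdsWithin_iff.1 (h.eventually_deriv_ne_zero hΩ hz)
  have hU : IsOpen (φ '' (Metric.ball z ε ∩ Ω)) :=
    h.isOpen_image hΩ (Metric.isOpen_ball.inter hΩ) inter_subset_right
  have hmem : φ '' (Metric.ball z ε ∩ Ω) ∈ 𝓝 (φ z) :=
    hU.mem_nhds (mem_image_of_mem φ ⟨Metric.mem_ball_self hε, hz⟩)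
  refine ((Complex.differentiableOn_compl_singleton_and_continuousAt_iff hmem).1
    ⟨?_, h.continuousAt_invFunOn hΩ hz⟩).differentiableAt hmem
  rintro _ ⟨⟨w, ⟨hwε, hw⟩, rfl⟩, hne⟩
  have hwz : w ≠ z := fun hwz => hne (congrArg φ hwz)
  exact (h.differentiableAt_invFunOn_of_deriv_ne_zero hΩ hw
    (hball ⟨hwε, hwz⟩)).differentiableWithinAt

theorem invFunOn (h : IsConformalHomeo Ω Ω' φ) (hΩ : IsOpen Ω) :
    IsConformalHomeo Ω' Ω (invFunOn φ Ω) := by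
  refine ⟨fun w hw => ?_, h.2.invOn_invFunOn.symm.bijOn h.2.surjOn.mapsTo_invFunOn h.2.mapsTo⟩
  obtain ⟨z, hz, rfl⟩ := h.2.surjOn hw
  exact (h.differentiableAt_invFunOn hΩ hz).differentiableWithinAt

theorem deriv_invFunOn_mul_deriv (h : IsConformalHomeo Ω Ω' φ) (hΩ : IsOpen Ω) {z : ℂ}
    (hz : z ∈ Ω) : deriv (Function.invFunOn φ Ω) (φ z) * deriv φ z = 1 := by
  have hcomp := (h.differentiableAt_invFunOn hΩ hz).hasDerivAt.comp z
    (h.differentiableAt hΩ hz).hasDerivAt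
  have hid : HasDerivAt (Function.invFunOn φ Ω ∘ φ) 1 z := by
    refine (hasDerivAt_id z).congr_of_eventuallyEq ?_
    filter_upwards [hΩ.mem_nhds hz] with w hw
    exact h.2.injOn.leftInvOn_invFunOn hw
  exact hcomp.unique hid

theorem deriv_ne_zero (h : IsConformalHomeo Ω Ω' φ) (hΩ : IsOpen Ω) {z : ℂ} (hz : z ∈ Ω) :
    deriv φ z ≠ 0 :=
  right_ne_zero_of_mul_eq_one (h.deriv_invFunOn_mul_deriv hΩ hz)

end IsConformalHomeo

end ConformalHomeo

section ChangeOfVariables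

theorem det_restrictScalars_toSpanSingleton (a : ℂ) :
    ((ContinuousLinearMap.toSpanSingleton ℂ a).restrictScalars ℝ : ℂ →L[ℝ] ℂ).det = ‖a‖ ^ 2 := by
  rw [ContinuousLinearMap.det, ContinuousLinearMap.coe_restrictScalars,
    LinearMap.det_restrictScalars]
  simp [Algebra.norm_complex_apply, Complex.normSq_eq_norm_sq]

variable {A s : Set ℂ} {F : ℂ → ℂ} {E : Type*} [NormedAddCommGroup E] [NormedSpace ℝ E]

theorem hasFDerivWithinAt_restrictScalars_of_isOpen (hA : IsOpen A) (hF : DifferentiableOn ℂ F A)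
    (hs : s ⊆ A) (z : ℂ) (hz : z ∈ s) : HasFDerivWithinAt F
      ((ContinuousLinearMap.toSpanSingleton ℂ (deriv F z)).restrictScalars ℝ) s z :=
  ((hF.differentiableAt (hA.mem_nhds
    (hs hz))).hasDerivAt.hasFDerivAt.restrictScalars ℝ).hasFDerivWithinAt

theorem lintegral_image_eq_of_holomorphic (hA : IsOpen A) (hF : DifferentiableOn ℂ F A)
    (hs : s ⊆ A) (hsm : MeasurableSet s) (hi : InjOn F s) (g : ℂ → ℝ≥0∞) :
    ∫⁻ w in F '' s, g w = ∫⁻ z in s, ‖deriv F z‖ₑ ^ (2 : ℝ) * g (F z) := by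
  rw [lintegral_image_eq_lintegral_abs_det_fderiv_mul volume hsm
    (hasFDerivWithinAt_restrictScalars_of_isOpen hA hF hs) hi]
  refine lintegral_congr fun z => ?_
  rw [det_restrictScalars_toSpanSingleton, abs_of_nonneg (by positivity),
    ENNReal.ofReal_pow (norm_nonneg _), ofReal_norm, ENNReal.rpow_two]

theorem integral_image_eq_of_holomorphic (hA : IsOpen A) (hF : DifferentiableOn ℂ F A)
    (hs : s ⊆ A) (hsm : MeasurableSet s) (hi : InjOn F s) (g : ℂ → E) :
    ∫ w in F '' s, g w = ∫ z in s, ‖deriv F z‖ ^ 2 • g (F z) := by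
  rw [integral_image_eq_integral_abs_det_fderiv_smul volume hsm
    (hasFDerivWithinAt_restrictScalars_of_isOpen hA hF hs) hi]
  simp_rw [det_restrictScalars_toSpanSingleton, abs_pow, abs_norm]

theorem integrableOn_image_iff_of_holomorphic (hA : IsOpen A) (hF : DifferentiableOn ℂ F A)
    (hs : s ⊆ A) (hsm : MeasurableSet s) (hi : InjOn F s) (g : ℂ → E) :
    IntegrableOn g (F '' s) ↔ IntegrableOn (fun z => ‖deriv F z‖ ^ 2 • g (F z)) s := by
  rw [integrableOn_image_iff_integrableOn_abs_det_fderiv_smul volume hsm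
    (hasFDerivWithinAt_restrictScalars_of_isOpen hA hF hs) hi]
  simp_rw [det_restrictScalars_toSpanSingleton, abs_pow, abs_norm]

theorem IsConformalHomeo.locallyIntegrableOn_comp {Ω Ω' : Set ℂ} {ψ : ℂ → ℂ}
    (h : IsConformalHomeo Ω' Ω ψ) (hΩ' : IsOpen Ω') {g : ℂ → E} (hg : LocallyIntegrableOn g Ω) :
    LocallyIntegrableOn (g ∘ ψ) Ω' := by
  rw [locallyIntegrableOn_iff hΩ'.isLocallyClosed]
  intro K hKΩ' hK
  have himage : IntegrableOn g (ψ '' K) :=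
    hg.integrableOn_compact_subset (h.2.mapsTo.mono_left hKΩ').image_subset
      (hK.image_of_continuousOn (h.1.continuousOn.mono hKΩ'))
  rw [integrableOn_image_iff_of_holomorphic hΩ' h.1 hKΩ' hK.measurableSet
    (h.2.injOn.mono hKΩ')] at himage
  have hne : ∀ z ∈ K, ‖deriv ψ z‖ ^ 2 ≠ 0 := fun z hz =>
    pow_ne_zero _ (norm_ne_zero_iff.2 (h.deriv_ne_zero hΩ' (hKΩ' hz)))
  have hc : ContinuousOn (fun z => (‖deriv ψ z‖ ^ 2)⁻¹) K :=
    ContinuousOn.inv₀ ((((h.1.deriv hΩ').continuousOn.mono hKΩ').norm).pow 2) hne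
  refine (himage.continuousOn_smul hc hK).congr_fun (fun z hz => ?_) hK.measurableSet
  exact inv_smul_smul₀ (hne z hz) _

end ChangeOfVariables

section Divergence

theorem integrable_mul_of_tsupport_subset {X : Type*} [TopologicalSpace X] [T2Space X]
    [MeasurableSpace X] [OpensMeasurableSpace X] {μ : Measure X} {Ω : Set X} {f g : X → ℝ}
    (hf : LocallyIntegrableOn f Ω μ) (hg : Continuous g) (hc : HasCompactSupport g)
    (hs : tsupport g ⊆ Ω) : Integrable (fun z => f z * g z) μ := by
  refine (integrableOn_iff_integrable_of_support_subset ?_).1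
    ((hf.integrableOn_compact_subset hs hc).mul_continuousOn hg.continuousOn hc)
  exact (Function.support_mul_subset_right _ _).trans (subset_tsupport g)

theorem indicator_mem_testFunctions {E F : Type*} [NormedAddCommGroup E] [NormedSpace ℝ E]
    [NormedAddCommGroup F] [NormedSpace ℝ F] {Ω K : Set E} {g : E → F} (hΩ : IsOpen Ω)
    (hK : IsCompact K) (hKΩ : K ⊆ Ω) (hg : ContDiffOn ℝ ∞ g Ω) (hg0 : ∀ z ∈ Ω \ K, g z = 0) :
    ContDiff ℝ ∞ (Ω.indicator g) ∧ HasCompactSupport (Ω.indicator g) ∧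
      tsupport (Ω.indicator g) ⊆ Ω := by
  have hsupp : Function.support (Ω.indicator g) ⊆ K := by
    intro z hz
    rw [Function.mem_support, indicator_apply_ne_zero] at hz
    by_contra hzK
    exact hz.2 (hg0 z ⟨hz.1, hzK⟩)
  have htsupp : tsupport (Ω.indicator g) ⊆ K := closure_minimal hsupp hK.isClosed
  refine ⟨contDiff_iff_contDiffAt.2 fun z => ?_,
    hK.of_isClosed_subset (isClosed_tsupport _) htsupp, htsupp.trans hKΩ⟩
  by_cases hz : z ∈ Ω
  · exact (hg.contDiffAt (hΩ.mem_nhds hz)).congr_of_eventuallyEq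
      (eqOn_indicator.eventuallyEq_of_mem (hΩ.mem_nhds hz))
  · refine (contDiffAt_const (c := (0 : F))).congr_of_eventuallyEq ?_
    filter_upwards [hK.isClosed.isOpen_compl.mem_nhds fun hzK => hz (hKΩ hzK)] with y hy
    exact Function.notMem_support.1 fun hys => hy (hsupp hys)

/-- The divergence of a real vector field on `ℂ = ℝ²`, in the convention of `HasWeakGradientOn`
that the vector `(a, b)` is written as `a + i b`. -/
noncomputable def divergence (X : ℂ → ℂ) (z : ℂ) : ℝ :=
  (fderiv ℝ X z 1).re + (fderiv ℝ X z Complex.I).im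

variable {Ω : Set ℂ} {f : ℂ → ℝ} {G : ℂ → ℂ}

theorem HasWeakGradientOn.integral_mul_clm_fderiv (hf : HasWeakGradientOn Ω f G) {X : ℂ → ℂ}
    (hX : ContDiff ℝ ∞ X) (hXc : HasCompactSupport X) (hXs : tsupport X ⊆ Ω) (L : ℂ →L[ℝ] ℝ)
    (v : ℂ) :
    IntegrableOn (fun z => f z * L (fderiv ℝ X z v)) Ω ∧
      IntegrableOn (fun z => inner ℝ (G z) v * L (X z)) Ω ∧
      ∫ z in Ω, f z * L (fderiv ℝ X z v) = -∫ z in Ω, inner ℝ (G z) v * L (X z) := by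
  have hη : ContDiff ℝ ∞ fun z => L (X z) := L.contDiff.comp hX
  have hηc : HasCompactSupport fun z => L (X z) := hXc.comp_left L.map_zero
  have hηs : tsupport (fun z => L (X z)) ⊆ Ω :=
    (closure_mono (Function.support_comp_subset L.map_zero X)).trans hXs
  have hfderiv : ∀ z, fderiv ℝ (fun z => L (X z)) z v = L (fderiv ℝ X z v) := fun z =>
    congrArg (· v) (L.hasFDerivAt.comp z (hX.differentiable (by simp) z).hasFDerivAt).fderiv
  have hGv : LocallyIntegrableOn (fun z => (inner ℝ (G z) v : ℝ)) Ω := fun x hx =>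
    let ⟨s, hs, hi⟩ := hf.2.1 x hx
    ⟨s, hs, hi.inner_const v⟩
  simp only [← hfderiv]
  exact ⟨(integrable_mul_of_tsupport_subset hf.1
      ((hη.continuous_fderiv (by simp)).clm_apply continuous_const) (hηc.fderiv_apply ℝ v)
      ((tsupport_fderiv_apply_subset ℝ v).trans hηs)).integrableOn,
    (integrable_mul_of_tsupport_subset hGv hη.continuous hηc hηs).integrableOn,
    hf.2.2 _ hη hηc hηs v⟩

theorem HasWeakGradientOn.integral_mul_divergence (hf : HasWeakGradientOn Ω f G) {X : ℂ → ℂ}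
    (hX : ContDiff ℝ ∞ X) (hXc : HasCompactSupport X) (hXs : tsupport X ⊆ Ω) :
    ∫ z in Ω, f z * divergence X z = -∫ z in Ω, inner ℝ (G z) (X z) := by
  obtain ⟨hf₁, hG₁, h₁⟩ := hf.integral_mul_clm_fderiv hX hXc hXs Complex.reCLM 1
  obtain ⟨hf₂, hG₂, h₂⟩ := hf.integral_mul_clm_fderiv hX hXc hXs Complex.imCLM Complex.I
  have hinner : ∀ z, inner ℝ (G z) (X z) = inner ℝ (G z) 1 * Complex.reCLM (X z) +
      inner ℝ (G z) Complex.I * Complex.imCLM (X z) := fun z => by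
    simp [Complex.inner, mul_comm]
  simp only [hinner, divergence, mul_add]
  rw [integral_add hG₁ hG₂, neg_add, ← h₁, ← h₂, ← integral_add hf₁ hf₂]
  rfl

end Divergence

section Composition

open ComplexConjugate

variable {Ω Ω' : Set ℂ} {f : ℂ → ℝ} {G : ℂ → ℂ}

/-- The pullback by the transposed derivative of `φ` of the vector field `η v` on `φ '' Ω`,
extended by `0`: the test field on `Ω` which corresponds to the test function `η` and the
direction `v` on `φ '' Ω`. -/
noncomputable def pullbackField (φ : ℂ → ℂ) (Ω : Set ℂ) (η : ℂ → ℝ) (v : ℂ) : ℂ → ℂ :=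
  Ω.indicator fun z => η (φ z) • (conj (deriv φ z) * v)

theorem pullbackField_mem_testFunctions {φ : ℂ → ℂ} (h : IsConformalHomeo Ω Ω' φ)
    (hΩ : IsOpen Ω) {η : ℂ → ℝ} (hη : ContDiff ℝ ∞ η) (hηc : HasCompactSupport η)
    (hηs : tsupport η ⊆ Ω') (v : ℂ) :
    ContDiff ℝ ∞ (pullbackField φ Ω η v) ∧ HasCompactSupport (pullbackField φ Ω η v) ∧
      tsupport (pullbackField φ Ω η v) ⊆ Ω := by
  have hinv := h.invFunOn hΩ
  have hφ : ContDiffOn ℝ ∞ φ Ω := (h.1.contDiffOn hΩ).restrict_scalars ℝ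
  have hφ' : ContDiffOn ℝ ∞ (deriv φ) Ω := ((h.1.deriv hΩ).contDiffOn hΩ).restrict_scalars ℝ
  refine indicator_mem_testFunctions hΩ (K := Function.invFunOn φ Ω '' tsupport η)
    (hηc.isCompact.image_of_continuousOn (hinv.1.continuousOn.mono hηs))
    (hinv.2.mapsTo.mono_left hηs).image_subset
    ((hη.comp_contDiffOn hφ).smul
      ((Complex.conjCLE.contDiff.comp_contDiffOn hφ').mul contDiffOn_const)) ?_
  rintro z ⟨hz, hzK⟩
  have hη0 : η (φ z) = 0 := image_eq_zero_of_notMem_tsupport fun hφz =>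
    hzK ⟨φ z, hφz, h.2.injOn.leftInvOn_invFunOn hz⟩
  rw [hη0, zero_smul]

/- As `φ'` is holomorphic, the derivatives of the factor `conj φ' * v` cancel in the divergence. -/
theorem divergence_pullbackField {φ : ℂ → ℂ} (hφ : DifferentiableOn ℂ φ Ω) (hΩ : IsOpen Ω)
    {η : ℂ → ℝ} (hη : Differentiable ℝ η) (v : ℂ) {z : ℂ} (hz : z ∈ Ω) :
    divergence (pullbackField φ Ω η v) z = ‖deriv φ z‖ ^ 2 * fderiv ℝ η (φ z) v := by
  have hφz := (hφ.differentiableAt (hΩ.mem_nhds hz)).hasDerivAt.hasFDerivAt.restrictScalars ℝ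
  have hφ'z := ((hφ.deriv hΩ).differentiableAt
    (hΩ.mem_nhds hz)).hasDerivAt.hasFDerivAt.restrictScalars ℝ
  have hXz : HasFDerivAt (pullbackField φ Ω η v) _ z :=
    (((hη (φ z)).hasFDerivAt.comp z hφz).smul
      ((Complex.conjCLE.toContinuousLinearMap.hasFDerivAt.comp z
        hφ'z).mul_const' v)).congr_of_eventuallyEq
      (eqOn_indicator.eventuallyEq_of_mem (hΩ.mem_nhds hz))
  have hfderiv : ∀ u, fderiv ℝ (pullbackField φ Ω η v) z u =
      η (φ z) • (conj (u * deriv (deriv φ) z) * v) +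
        fderiv ℝ η (φ z) (u * deriv φ z) • (conj (deriv φ z) * v) := fun u => by
    rw [hXz.fderiv]
    simp [mul_comm v]
  have hdecomp : ‖deriv φ z‖ ^ 2 * fderiv ℝ η (φ z) v
      = (conj (deriv φ z) * v).re * fderiv ℝ η (φ z) (deriv φ z)
        + (conj (deriv φ z) * v).im * fderiv ℝ η (φ z) (Complex.I * deriv φ z) := by
    simp only [← smul_eq_mul (α := ℝ), ← map_smul, ← map_add]
    congr 1
    have hnorm : ((‖deriv φ z‖ ^ 2 : ℝ) : ℂ) = deriv φ z * conj (deriv φ z) := by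
      rw [Complex.mul_conj, Complex.normSq_eq_norm_sq]
    simp only [Complex.real_smul, hnorm]
    conv_lhs => rw [mul_assoc, ← Complex.re_add_im (conj (deriv φ z) * v)]
    ring
  rw [hdecomp, divergence, hfderiv, hfderiv]
  simp only [one_mul, Complex.real_smul, Complex.add_re, Complex.mul_re, Complex.ofReal_re,
    Complex.conj_re, Complex.conj_im, neg_mul, sub_neg_eq_add, Complex.ofReal_im, Complex.mul_im,
    zero_mul, sub_zero, map_mul, Complex.conj_I, smul_neg, Complex.add_im, Complex.neg_im,
    Complex.I_re, Complex.I_im, mul_neg, zero_add, neg_zero, add_zero]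
  ring

theorem norm_sq_mul_inner_conj_mul {a b : ℂ} (hba : b * a = 1) (g v : ℂ) :
    ‖a‖ ^ 2 * inner ℝ g (conj b * v) = inner ℝ (conj a * g) v := by
  have hmul : ((‖a‖ ^ 2 : ℝ) : ℂ) * (conj b * v) = a * v := by
    rw [← Complex.normSq_eq_norm_sq, ← Complex.mul_conj]
    have hconj := congrArg conj hba
    rw [map_mul, map_one] at hconj
    linear_combination (a * v) * hconj
  rw [← real_inner_smul_right, Complex.real_smul, hmul]
  simp only [Complex.inner, map_mul, Complex.conj_conj]
  ring_nf

theorem HasWeakGradientOn.comp {ψ : ℂ → ℂ} (hf : HasWeakGradientOn Ω f G)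
    (h : IsConformalHomeo Ω' Ω ψ) (hΩ' : IsOpen Ω') :
    HasWeakGradientOn Ω' (f ∘ ψ) fun w => conj (deriv ψ w) * G (ψ w) := by
  have hc : ContinuousOn (fun w => conj (deriv ψ w)) Ω' :=
    Complex.continuous_conj.comp_continuousOn (h.1.deriv hΩ').continuousOn
  refine ⟨h.locallyIntegrableOn_comp hΩ' hf.1,
    (h.locallyIntegrableOn_comp hΩ' hf.2.1).continuousOn_mul hc hΩ'.isLocallyClosed,
    fun η hη hηc hηs v => ?_⟩
  have hΩ := h.isOpen_target hΩ'
  have hinv := h.invFunOn hΩ'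
  set φ := Function.invFunOn ψ Ω'
  have hφψ : ∀ w ∈ Ω', φ (ψ w) = w := h.2.injOn.leftInvOn_invFunOn
  obtain ⟨hX, hXc, hXs⟩ := pullbackField_mem_testFunctions hinv hΩ hη hηc hηs v
  have htest := hf.integral_mul_divergence hX hXc hXs
  rw [← h.2.image_eq] at htest
  simp only [integral_image_eq_of_holomorphic hΩ' h.1 subset_rfl hΩ'.measurableSet h.2.injOn]
    at htest
  have hderiv : ∀ w ∈ Ω', deriv φ (ψ w) * deriv ψ w = 1 := fun w hw =>
    h.deriv_invFunOn_mul_deriv hΩ' hw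
  convert htest using 1
  · refine setIntegral_congr_fun hΩ'.measurableSet fun w hw => ?_
    have hnorm : ‖deriv φ (ψ w)‖ * ‖deriv ψ w‖ = 1 := by rw [← norm_mul, hderiv w hw, norm_one]
    simp only [h.2.image_eq, Function.comp_apply, smul_eq_mul]
    rw [divergence_pullbackField hinv.1 hΩ (hη.differentiable (by simp)) v (h.2.mapsTo hw),
      hφψ w hw]
    linear_combination (-f (ψ w) * fderiv ℝ η w v *
      (‖deriv φ (ψ w)‖ * ‖deriv ψ w‖ + 1)) * hnorm
  · refine congrArg Neg.neg (setIntegral_congr_fun hΩ'.measurableSet fun w hw => ?_)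
    have hX : pullbackField φ Ω η v (ψ w) = η w • (conj (deriv φ (ψ w)) * v) := by
      rw [pullbackField, indicator_of_mem (h.2.mapsTo hw), hφψ w hw]
    simp only [h.2.image_eq, hX, inner_smul_right, smul_eq_mul]
    rw [← norm_sq_mul_inner_conj_mul (hderiv w hw)]
    ring

theorem gradNorm_comp_le {ψ : ℂ → ℂ} (h : IsConformalHomeo Ω' Ω ψ) (hΩ' : IsOpen Ω') {p q : ℝ}
    (hq : 0 < q) (hqp : q < p) (hG : LocallyIntegrableOn G Ω) :
    gradNorm q Ω' (fun w => conj (deriv ψ w) * G (ψ w)) ≤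
      (∫⁻ w in Ω', ‖deriv ψ w‖ₑ ^ ((p - 2) * q / (p - q))) ^ ((p - q) / (p * q)) *
        gradNorm p Ω G := by
  have hp : 0 < p := hq.trans hqp
  have hpq : 0 < p - q := sub_pos.2 hqp
  have hψm : AEMeasurable (fun w => ‖deriv ψ w‖ₑ) (volume.restrict Ω') :=
    ((h.1.deriv hΩ').continuousOn.aestronglyMeasurable hΩ'.measurableSet).enorm
  have hGm : AEMeasurable (fun w => ‖G (ψ w)‖ₑ) (volume.restrict Ω') :=
    (h.locallyIntegrableOn_comp hΩ' hG).aestronglyMeasurable.enorm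
  have hfactor : ∀ w ∈ Ω', ‖conj (deriv ψ w) * G (ψ w)‖ₑ =
      ‖deriv ψ w‖ₑ ^ ((p - 2) / p) * (‖deriv ψ w‖ₑ ^ (2 / p) * ‖G (ψ w)‖ₑ) := fun w hw => by
    rw [← mul_assoc, ← ENNReal.rpow_add _ _ (enorm_ne_zero.2 (h.deriv_ne_zero hΩ' hw))
      enorm_ne_top, ← add_div, sub_add_cancel, div_self hp.ne', ENNReal.rpow_one, enorm_mul,
      RCLike.enorm_conj]
  have hchange : ∫⁻ w in Ω', (‖deriv ψ w‖ₑ ^ (2 / p) * ‖G (ψ w)‖ₑ) ^ p =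
      ∫⁻ z in Ω, ‖G z‖ₑ ^ p := by
    rw [← h.2.image_eq, lintegral_image_eq_of_holomorphic hΩ' h.1 subset_rfl
      hΩ'.measurableSet h.2.injOn]
    refine lintegral_congr fun w => ?_
    rw [ENNReal.mul_rpow_of_nonneg _ _ hp.le, ← ENNReal.rpow_mul, div_mul_cancel₀ _ hp.ne']
  have hHolder := ENNReal.lintegral_Lp_mul_le_Lq_mul_Lr hq
    ((lt_div_iff₀ hpq).2 (by nlinarith) : q < p * q / (p - q)) (r := p)
    (by field_simp; ring) (volume.restrict Ω') (hψm.pow_const ((p - 2) / p))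
    ((hψm.pow_const (2 / p)).mul hGm)
  have hexp : (p - 2) / p * (p * q / (p - q)) = (p - 2) * q / (p - q) := by field_simp
  simp only [Pi.mul_apply, hchange, ← ENNReal.rpow_mul, hexp, one_div_div] at hHolder
  simp only [gradNorm]
  rwa [setLIntegral_congr_fun hΩ'.measurableSet fun w hw => by rw [hfactor w hw]]

theorem eLpNorm_eq_gradNorm {p : ℝ} (hp : 0 < p) (Ω : Set ℂ) (G : ℂ → ℂ) :
    eLpNorm G (ENNReal.ofReal p) (volume.restrict Ω) = gradNorm p Ω G := by
  rw [eLpNorm_eq_lintegral_rpow_enorm_toReal (by simpa using hp) ENNReal.ofReal_ne_top,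
    ENNReal.toReal_ofReal hp.le, gradNorm]

theorem MemHomSobolev.gradNorm_lt_top {p : ℝ} (hf : MemHomSobolev p Ω f G) (hp : 0 < p) :
    gradNorm p Ω G < ⊤ :=
  eLpNorm_eq_gradNorm hp Ω G ▸ hf.2.2

theorem compositionNorm_le {ψ : ℂ → ℂ} (h : IsConformalHomeo Ω' Ω ψ) (hΩ' : IsOpen Ω') {p q : ℝ}
    (hq : 0 < q) (hqp : q < p) :
    compositionNorm p q Ω Ω' ψ ≤
      (∫⁻ w in Ω', ‖deriv ψ w‖ₑ ^ ((p - 2) * q / (p - q))) ^ ((p - q) / (p * q)) := by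
  rcases eq_top_or_lt_top ((∫⁻ w in Ω', ‖deriv ψ w‖ₑ ^ ((p - 2) * q / (p - q))) ^
    ((p - q) / (p * q))) with htop | hfin
  · exact htop ▸ le_top
  refine sInf_le ⟨hfin, fun f G hf => ?_⟩
  have hgrad := hf.1.comp h hΩ'
  have hle := gradNorm_comp_le h hΩ' hq hqp hf.1.2.1
  refine ⟨_, ⟨hgrad, hgrad.2.1.aestronglyMeasurable, ?_⟩, hle⟩
  rw [eLpNorm_eq_gradNorm hq]
  exact hle.trans_lt (ENNReal.mul_lt_top hfin (hf.gradNorm_lt_top (hq.trans hqp)))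

theorem compositionNorm_lt_top {ψ : ℂ → ℂ} (h : IsConformalHomeo Ω' Ω ψ) (hΩ' : IsOpen Ω')
    {p q : ℝ} (hq : 0 < q) (hqp : q < p)
    (hint : ∫⁻ w in Ω', ‖deriv ψ w‖ₑ ^ ((p - 2) * q / (p - q)) < ⊤) :
    compositionNorm p q Ω Ω' ψ < ⊤ :=
  (compositionNorm_le h hΩ' hq hqp).trans_lt (ENNReal.rpow_lt_top_of_nonneg
    (div_nonneg (sub_nonneg.2 hqp.le) (mul_pos (hq.trans hqp) hq).le) hint.ne)

theorem infDistConst_comp_leftInvOn {φ ψ : ℂ → ℂ} (h : IsConformalHomeo Ω Ω' φ) (hΩ : IsOpen Ω)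
    (hψφ : LeftInvOn ψ φ Ω) (r : ℝ) (f : ℂ → ℝ) :
    infDistConst r Ω' (fun _ => 1) (f ∘ ψ) = infDistConst r Ω (conformalWeight φ) f := by
  unfold infDistConst
  congr! 3 with c
  rw [← h.2.image_eq, lintegral_image_eq_of_holomorphic hΩ h.1 subset_rfl
      hΩ.measurableSet h.2.injOn]
  refine setLIntegral_congr_fun hΩ.measurableSet fun z hz => ?_
  simp only [Function.comp_apply, hψφ hz, ENNReal.ofReal_one, mul_one, conformalWeight]
  rw [mul_comm, ENNReal.ofReal_pow (norm_nonneg _), ofReal_norm, ENNReal.rpow_two]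

end Composition

section Gagliardo

open Metric Module Real
open scoped NNReal

theorem enorm_fderiv_smul_le {E F : Type*} [NormedAddCommGroup E] [NormedSpace ℝ E]
    [NormedAddCommGroup F] [NormedSpace ℝ F] {c : E → ℝ} {u : E → F} {x : E}
    (hc : DifferentiableAt ℝ c x) (hu : DifferentiableAt ℝ u x) :
    ‖fderiv ℝ (fun y => c y • u y) x‖ₑ ≤ ‖c x‖ₑ * ‖fderiv ℝ u x‖ₑ + ‖fderiv ℝ c x‖ₑ * ‖u x‖ₑ := by
  simp only [← ofReal_norm]
  rw [← ENNReal.ofReal_mul (norm_nonneg _), ← ENNReal.ofReal_mul (norm_nonneg _),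
    ← ENNReal.ofReal_add (by positivity) (by positivity), fderiv_fun_smul hc hu]
  refine ENNReal.ofReal_le_ofReal ((norm_add_le _ _).trans_eq ?_)
  rw [norm_smul, ContinuousLinearMap.norm_smulRight_apply]

section Interior

variable {E F : Type*} [NormedAddCommGroup E] [NormedSpace ℝ E] [FiniteDimensional ℝ E]
  [NormedAddCommGroup F] [NormedSpace ℝ F]

theorem exists_contDiff_eq_one_on_ball (x : E) {δ ρ : ℝ} (hδ : 0 < δ) (hδρ : δ < ρ) :
    ∃ (χ : E → ℝ) (M : ℝ≥0), ContDiff ℝ ∞ χ ∧ HasCompactSupport χ ∧ tsupport χ ⊆ ball x ρ ∧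
      (∀ z ∈ ball x δ, χ z = 1) ∧ ∀ z, ‖χ z‖ₑ ≤ M ∧ ‖fderiv ℝ χ z‖ₑ ≤ M := by
  let χ : ContDiffBump x := ⟨δ, (δ + ρ) / 2, hδ, by linarith⟩
  have hχ : ContDiff ℝ ∞ χ := χ.contDiff
  obtain ⟨M, hM⟩ := (χ.hasCompactSupport.fderiv ℝ).exists_bound_of_continuous
    (hχ.continuous_fderiv (by simp))
  refine ⟨χ, max 1 M.toNNReal, hχ, χ.hasCompactSupport, ?_, fun z hz =>
    χ.one_of_mem_closedBall (ball_subset_closedBall hz), fun z => ⟨?_, ?_⟩⟩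
  · rw [χ.tsupport_eq]
    exact closedBall_subset_ball (by change (δ + ρ) / 2 < ρ; linarith)
  · rw [Real.enorm_eq_ofReal χ.nonneg]
    exact (ENNReal.ofReal_le_one.2 χ.le_one).trans (by simp)
  · rw [← ofReal_norm]
    exact (ENNReal.ofReal_le_ofReal (hM z)).trans (ENNReal.coe_le_coe.2 (le_max_right _ _))

theorem exists_setLIntegral_rpow_ball_le [MeasurableSpace E] [BorelSpace E] (μ : Measure E)
    [μ.IsAddHaarMeasure] {p : ℝ} (hp : Real.HolderConjugate (finrank ℝ E) p) (x : E) {δ ρ : ℝ}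
    (hδ : 0 < δ) (hδρ : δ < ρ) :
    ∃ C : ℝ≥0, ∀ u : E → F, ContDiff ℝ 1 u → ∫⁻ z in ball x δ, ‖u z‖ₑ ^ p ∂μ ≤
      C * (∫⁻ z in ball x ρ, (‖u z‖ₑ + ‖fderiv ℝ u z‖ₑ) ∂μ) ^ p := by
  obtain ⟨χ, M, hχ, hχc, hχρ, hχδ, hM⟩ := exists_contDiff_eq_one_on_ball x hδ hδρ
  replace hχ : ContDiff ℝ 1 χ := hχ.of_le (by simp)
  have hp0 : 0 ≤ p := hp.symm.nonneg
  refine ⟨lintegralPowLePowLIntegralFDerivConst μ p * M ^ p, fun u hu => ?_⟩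
  set w : E → F := fun z => χ z • u z
  have hw_fderiv : ∀ z, ‖fderiv ℝ w z‖ₑ ≤
      (ball x ρ).indicator (fun z => M * (‖u z‖ₑ + ‖fderiv ℝ u z‖ₑ)) z := by
    intro z
    by_cases hz : z ∈ ball x ρ
    · rw [indicator_of_mem hz, mul_add, add_comm]
      refine (enorm_fderiv_smul_le (hχ.differentiable one_ne_zero z)
        (hu.differentiable one_ne_zero z)).trans ?_
      gcongr
      exacts [(hM z).1, (hM z).2]
    · have hz' : z ∉ tsupport (fderiv ℝ w) := fun h =>
        hz (hχρ (tsupport_smul_subset_left χ u (tsupport_fderiv_subset ℝ h)))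
      rw [image_eq_zero_of_notMem_tsupport hz', ← ofReal_norm, norm_zero, ENNReal.ofReal_zero]
      exact zero_le
  calc ∫⁻ z in ball x δ, ‖u z‖ₑ ^ p ∂μ = ∫⁻ z in ball x δ, ‖w z‖ₑ ^ p ∂μ :=
        setLIntegral_congr_fun measurableSet_ball fun z hz => by
          simp only [w, hχδ z hz, one_smul]
    _ ≤ ∫⁻ z, ‖w z‖ₑ ^ p ∂μ := setLIntegral_le_lintegral _ _
    _ ≤ lintegralPowLePowLIntegralFDerivConst μ p * (∫⁻ z, ‖fderiv ℝ w z‖ₑ ∂μ) ^ p :=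
        lintegral_pow_le_pow_lintegral_fderiv μ (hχ.smul hu) hχc.smul_right hp
    _ ≤ lintegralPowLePowLIntegralFDerivConst μ p *
        (M * ∫⁻ z in ball x ρ, (‖u z‖ₑ + ‖fderiv ℝ u z‖ₑ) ∂μ) ^ p := by
        gcongr
        refine (lintegral_mono hw_fderiv).trans ?_
        rw [lintegral_indicator measurableSet_ball, ← lintegral_const_mul' _ _ (by simp)]
    _ = _ := by
        rw [ENNReal.mul_rpow_of_nonneg _ _ hp0, ← mul_assoc, ENNReal.coe_mul,
          ENNReal.coe_rpow_of_nonneg _ hp0]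

end Interior

theorem enorm_sub_le_lintegral_enorm_deriv {F : Type*} [NormedAddCommGroup F] [NormedSpace ℝ F]
    {w : ℝ → F} (hw : ContDiff ℝ 1 w) {a b x t : ℝ} (hx : x ∈ Ioo a b) (ht : t ∈ Ioo a b) :
    ‖w x - w t‖ₑ ≤ ∫⁻ s in Ioo a b, ‖deriv w s‖ₑ := by
  wlog htx : t ≤ x generalizing x t
  · rw [enorm_sub_rev]
    exact this ht hx (le_of_not_ge htx)
  · exact (enorm_sub_le_lintegral_deriv_of_contDiffOn_Icc hw.contDiffOn htx).trans
      (lintegral_mono_set (Icc_subset_Ioo ht.1 hx.2))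

theorem enorm_le_lintegral_enorm_add_deriv {F : Type*} [NormedAddCommGroup F] [NormedSpace ℝ F]
    {w : ℝ → F} (hw : ContDiff ℝ 1 w) {a b x : ℝ} (hx : x ∈ Ioo a b) {L : ℝ≥0∞}
    (hL : 1 ≤ ENNReal.ofReal (b - a) * L) :
    ‖w x‖ₑ ≤ ∫⁻ s in Ioo a b, (L * ‖w s‖ₑ + ‖deriv w s‖ₑ) := by
  rw [lintegral_add_right _ (hw.continuous_deriv le_rfl).enorm.measurable,
    lintegral_const_mul _ hw.continuous.enorm.measurable, ← tsub_le_iff_right]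
  set J := ∫⁻ s in Ioo a b, ‖deriv w s‖ₑ
  have hJ : ∀ t ∈ Ioo a b, ‖w x‖ₑ - J ≤ ‖w t‖ₑ := fun t ht => by
    rw [tsub_le_iff_right]
    calc ‖w x‖ₑ ≤ ‖w t‖ₑ + ‖w x - w t‖ₑ := by simpa using enorm_add_le (w t) (w x - w t)
      _ ≤ ‖w t‖ₑ + J := by gcongr; exact enorm_sub_le_lintegral_enorm_deriv hw hx ht
  calc ‖w x‖ₑ - J ≤ (‖w x‖ₑ - J) * (ENNReal.ofReal (b - a) * L) := le_mul_of_one_le_right' hL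
    _ = L * ∫⁻ _ in Ioo a b, (‖w x‖ₑ - J) := by
        rw [setLIntegral_const, Real.volume_Ioo]; ring
    _ ≤ _ := by gcongr L * ?_; exact setLIntegral_mono' measurableSet_Ioo hJ

theorem lintegral_lintegral_sq_le_of_rectangle {F : Type*} [NormedAddCommGroup F] [NormedSpace ℝ F]
    {v : ℝ → ℝ → F} (hx : ∀ y, ContDiff ℝ 1 fun s => v s y) (hy : ∀ x, ContDiff ℝ 1 (v x))
    {a b c d : ℝ} {L : ℝ≥0∞} (hab : 1 ≤ ENNReal.ofReal (b - a) * L)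
    (hcd : 1 ≤ ENNReal.ofReal (d - c) * L) {H : ℝ → ℝ → ℝ≥0∞}
    (hH : Measurable (Function.uncurry H))
    (hHx : ∀ x ∈ Ioo a b, ∀ y ∈ Ioo c d, L * ‖v x y‖ₑ + ‖deriv (fun s => v s y) x‖ₑ ≤ H x y)
    (hHy : ∀ x ∈ Ioo a b, ∀ y ∈ Ioo c d, L * ‖v x y‖ₑ + ‖deriv (v x) y‖ₑ ≤ H x y) :
    ∫⁻ x in Ioo a b, ∫⁻ y in Ioo c d, ‖v x y‖ₑ ^ (2 : ℝ) ≤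
      (∫⁻ x in Ioo a b, ∫⁻ y in Ioo c d, H x y) ^ (2 : ℝ) := by
  have hcol : ∀ x ∈ Ioo a b, ∀ y ∈ Ioo c d, ‖v x y‖ₑ ≤ ∫⁻ t in Ioo c d, H x t :=
    fun x hxm y hym => (enorm_le_lintegral_enorm_add_deriv (hy x) hym hcd).trans
      (setLIntegral_mono' measurableSet_Ioo fun t ht => hHy x hxm t ht)
  have hrow : ∀ x ∈ Ioo a b, ∀ y ∈ Ioo c d, ‖v x y‖ₑ ≤ ∫⁻ s in Ioo a b, H s y :=
    fun x hxm y hym => (enorm_le_lintegral_enorm_add_deriv (hx y) hxm hab).trans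
      (setLIntegral_mono' measurableSet_Ioo fun s hs => hHx s hs y hym)
  calc ∫⁻ x in Ioo a b, ∫⁻ y in Ioo c d, ‖v x y‖ₑ ^ (2 : ℝ)
      ≤ ∫⁻ x in Ioo a b, ∫⁻ y in Ioo c d, (∫⁻ t in Ioo c d, H x t) * ∫⁻ s in Ioo a b, H s y := by
        refine setLIntegral_mono' measurableSet_Ioo fun x hxm =>
          setLIntegral_mono' measurableSet_Ioo fun y hym => ?_
        rw [ENNReal.rpow_two, sq]
        exact mul_le_mul' (hcol x hxm y hym) (hrow x hxm y hym)
    _ = (∫⁻ x in Ioo a b, ∫⁻ t in Ioo c d, H x t) * ∫⁻ y in Ioo c d, ∫⁻ s in Ioo a b, H s y := by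
        have hcol_meas : Measurable fun x => ∫⁻ t in Ioo c d, H x t := hH.lintegral_prod_right'
        have hrow_meas : Measurable fun y => ∫⁻ s in Ioo a b, H s y := hH.lintegral_prod_left'
        rw [← lintegral_mul_const _ hcol_meas]
        exact lintegral_congr fun x => lintegral_const_mul _ hrow_meas
    _ = _ := by
        rw [ENNReal.rpow_two, sq,
          lintegral_lintegral_swap (f := fun y s => H s y) (hH.comp measurable_swap).aemeasurable]

theorem setLIntegral_annulus {g : ℂ → ℝ≥0∞} (hg : Measurable g) {a b : ℝ} (ha : 0 ≤ a) :
    ∫⁻ z in {z : ℂ | ‖z‖ ∈ Ioo a b}, g z = ∫⁻ ρ in Ioo a b, ∫⁻ θ in Ioo (-π) π,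
      ENNReal.ofReal ρ * g (ρ * Complex.exp (θ * Complex.I)) := by
  have hA : MeasurableSet {z : ℂ | ‖z‖ ∈ Ioo a b} := measurable_norm measurableSet_Ioo
  have hpolar : ∀ x : ℝ × ℝ,
      Complex.polarCoord.symm x = x.1 * Complex.exp (x.2 * Complex.I) := fun x => by
    rw [Complex.polarCoord_symm_apply, Complex.exp_mul_I, Complex.ofReal_cos, Complex.ofReal_sin]
  set A' := (fun x => Complex.polarCoord.symm x) ⁻¹' {z : ℂ | ‖z‖ ∈ Ioo a b}
  have hA' : MeasurableSet A' := by
    refine (Continuous.measurable ?_) hA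
    simp only [hpolar]
    fun_prop
  have hinter : A' ∩ polarCoord.target = Ioo a b ×ˢ Ioo (-π) π := by
    ext x
    have hmem : x ∈ A' ↔ |x.1| ∈ Ioo a b := by
      rw [← Complex.norm_polarCoord_symm]; rfl
    rw [mem_inter_iff, hmem, polarCoord_target]
    refine ⟨fun ⟨h, h0, hθ⟩ => ⟨by rwa [abs_of_pos h0] at h, hθ⟩, fun ⟨h, hθ⟩ => ?_⟩
    have h0 : 0 < x.1 := ha.trans_lt h.1
    exact ⟨by rwa [abs_of_pos h0], h0, hθ⟩
  calc ∫⁻ z in {z : ℂ | ‖z‖ ∈ Ioo a b}, g z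
      = ∫⁻ x in polarCoord.target, A'.indicator
          (fun x => ENNReal.ofReal x.1 * g (x.1 * Complex.exp (x.2 * Complex.I))) x := by
        rw [← lintegral_indicator hA, ← Complex.lintegral_comp_polarCoord_symm]
        refine lintegral_congr fun x => ?_
        rw [← indicator_const_smul_apply]
        simp only [← hpolar]
        rfl
    _ = _ := by
        rw [setLIntegral_indicator hA', hinter]
        exact setLIntegral_prod (μ := volume) (ν := volume) _ (by fun_prop)

theorem one_le_ofReal_mul_four {x : ℝ} (h : 1 / 4 ≤ x) : 1 ≤ ENNReal.ofReal x * 4 := by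
  rw [show (4 : ℝ≥0∞) = ENNReal.ofReal 4 by norm_num, ← ENNReal.ofReal_mul (by linarith),
    ENNReal.one_le_ofReal]
  linarith

theorem enorm_deriv_comp_le {E F : Type*} [NormedAddCommGroup E] [NormedSpace ℝ E]
    [NormedAddCommGroup F] [NormedSpace ℝ F] {u : E → F} {γ : ℝ → E} {γ' : E} {t : ℝ}
    (hu : DifferentiableAt ℝ u (γ t)) (hγ : HasDerivAt γ γ' t) (hγ' : ‖γ'‖ ≤ 1) :
    ‖deriv (fun s => u (γ s)) t‖ₑ ≤ ‖fderiv ℝ u (γ t)‖ₑ := by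
  have h : deriv (fun s => u (γ s)) t = fderiv ℝ u (γ t) γ' :=
    (hu.hasFDerivAt.comp_hasDerivAt t hγ).deriv
  rw [h, ← ofReal_norm, ← ofReal_norm]
  exact ENNReal.ofReal_le_ofReal (ContinuousLinearMap.unit_le_opNorm _ _ hγ')

theorem lintegral_lintegral_sq_polar_le {u : ℂ → ℝ} (hu : ContDiff ℝ 1 u) {ρ : ℝ}
    (hρ : ρ ∈ Icc (1 / 2 : ℝ) 1) :
    ∫⁻ s in Ioo (1 / 4) ρ, ∫⁻ θ in Ioo (-π) π,
        ‖u (s * Complex.exp (θ * Complex.I))‖ₑ ^ (2 : ℝ) ≤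
      (∫⁻ s in Ioo (1 / 4) ρ, ∫⁻ θ in Ioo (-π) π, 4 * (‖u (s * Complex.exp (θ * Complex.I))‖ₑ +
        ‖fderiv ℝ u (s * Complex.exp (θ * Complex.I))‖ₑ)) ^ (2 : ℝ) := by
  have hc := hu.continuous
  have hd := hu.differentiable one_ne_zero
  have hm : Measurable fun z => 4 * (‖u z‖ₑ + ‖fderiv ℝ u z‖ₑ) := by fun_prop
  have hbound : ∀ {z : ℂ} {e : ℝ≥0∞}, e ≤ ‖fderiv ℝ u z‖ₑ →
      4 * ‖u z‖ₑ + e ≤ 4 * (‖u z‖ₑ + ‖fderiv ℝ u z‖ₑ) := fun h => by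
    rw [mul_add]
    gcongr
    exact h.trans (le_mul_of_one_le_left' (by norm_num))
  have hradial : ∀ s θ : ℝ, HasDerivAt (fun s : ℝ => s * Complex.exp (θ * Complex.I))
      (Complex.exp (θ * Complex.I)) s := fun s θ => by
    simpa using (Complex.ofRealCLM.hasDerivAt (x := s)).mul_const (Complex.exp (θ * Complex.I))
  have hangular : ∀ s θ : ℝ, HasDerivAt (fun θ : ℝ => s * Complex.exp (θ * Complex.I))
      (s * (Complex.exp (θ * Complex.I) * Complex.I)) θ := fun s θ => by
    simpa using
      (((Complex.ofRealCLM.hasDerivAt (x := θ)).mul_const Complex.I).cexp).const_mul (s : ℂ)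
  refine lintegral_lintegral_sq_le_of_rectangle
    (v := fun s θ => u (s * Complex.exp (θ * Complex.I)))
    (fun θ => hu.comp ?_) (fun s => hu.comp ?_) (one_le_ofReal_mul_four (by linarith [hρ.1]))
    (one_le_ofReal_mul_four (by linarith [pi_gt_three])) (hm.comp (by fun_prop))
    (fun s _ θ _ => hbound (enorm_deriv_comp_le (hd _) (hradial s θ) ?_))
    (fun s hs θ _ => hbound (enorm_deriv_comp_le (hd _) (hangular s θ) ?_))
  · exact (Complex.ofRealCLM.contDiff).mul contDiff_const
  · exact contDiff_const.mul ((Complex.ofRealCLM.contDiff).mul contDiff_const).cexp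
  · rw [Complex.norm_exp_ofReal_mul_I]
  · rw [norm_mul, norm_mul, Complex.norm_exp_ofReal_mul_I, Complex.norm_I, Complex.norm_real,
      Real.norm_of_nonneg (by linarith [hs.1])]
    linarith [hs.2, hρ.2]

theorem setLIntegral_sq_annulus_le {u : ℂ → ℝ} (hu : ContDiff ℝ 1 u) {ρ : ℝ}
    (hρ : ρ ∈ Icc (1 / 2 : ℝ) 1) :
    ∫⁻ z in {z : ℂ | ‖z‖ ∈ Ioo (1 / 4) ρ}, ‖u z‖ₑ ^ (2 : ℝ) ≤
      (16 * ∫⁻ z in {z : ℂ | ‖z‖ ∈ Ioo (1 / 4) ρ}, (‖u z‖ₑ + ‖fderiv ℝ u z‖ₑ)) ^ (2 : ℝ) := by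
  have hc := hu.continuous
  rw [setLIntegral_annulus (by fun_prop) (by norm_num),
    setLIntegral_annulus (by fun_prop) (by norm_num)]
  refine le_trans ?_ ((lintegral_lintegral_sq_polar_le hu hρ).trans ?_)
  · exact setLIntegral_mono' measurableSet_Ioo fun s hs => lintegral_mono fun θ =>
      mul_le_of_le_one_left' (ENNReal.ofReal_le_one.2 (hs.2.le.trans hρ.2))
  · refine ENNReal.rpow_le_rpow ?_ zero_le_two
    rw [← lintegral_const_mul' _ _ (by simp)]
    refine setLIntegral_mono' measurableSet_Ioo fun s hs => ?_
    rw [← lintegral_const_mul' _ _ (by simp)]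
    refine lintegral_mono fun θ => ?_
    rw [← mul_assoc, show (16 : ℝ≥0∞) = 4 * 4 by norm_num, mul_assoc 4 4,
      mul_comm 4 (ENNReal.ofReal s)]
    gcongr
    exact le_mul_of_one_le_right' (one_le_ofReal_mul_four hs.1.le)

theorem exists_setLIntegral_sq_ball_le : ∃ C : ℝ≥0, ∀ ρ ∈ Icc (1 / 2 : ℝ) 1,
    ∀ u : ℂ → ℝ, ContDiff ℝ 1 u → ∫⁻ z in ball 0 ρ, ‖u z‖ₑ ^ (2 : ℝ) ≤
      C * (∫⁻ z in ball 0 ρ, (‖u z‖ₑ + ‖fderiv ℝ u z‖ₑ)) ^ (2 : ℝ) := by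
  have h2 : Real.HolderConjugate (finrank ℝ ℂ) 2 := by
    rw [Complex.finrank_real_complex]; exact Real.HolderConjugate.two_two
  obtain ⟨C, hC⟩ := exists_setLIntegral_rpow_ball_le (F := ℝ) (volume : Measure ℂ) h2 0
    (δ := 1 / 3) (ρ := 1 / 2) (by norm_num) (by norm_num)
  refine ⟨16 ^ (2 : ℝ) + C, fun ρ hρ u hu => ?_⟩
  set M := ∫⁻ z in ball 0 ρ, (‖u z‖ₑ + ‖fderiv ℝ u z‖ₑ) with hM
  have hcover : ball (0 : ℂ) ρ ⊆ {z : ℂ | ‖z‖ ∈ Ioo (1 / 4) ρ} ∪ ball 0 (1 / 3) := fun z hz => by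
    rw [mem_ball_zero_iff] at hz
    rcases lt_or_ge (1 / 4) ‖z‖ with h | h
    · exact Or.inl ⟨h, hz⟩
    · exact Or.inr (mem_ball_zero_iff.2 (by linarith))
  have hannulus : ∫⁻ z in {z : ℂ | ‖z‖ ∈ Ioo (1 / 4) ρ}, ‖u z‖ₑ ^ (2 : ℝ) ≤
      (16 * M) ^ (2 : ℝ) := by
    refine (setLIntegral_sq_annulus_le hu hρ).trans ?_
    rw [hM]
    gcongr
    exact fun z hz => mem_ball_zero_iff.2 hz.2
  have hinterior : ∫⁻ z in ball (0 : ℂ) (1 / 3), ‖u z‖ₑ ^ (2 : ℝ) ≤ C * M ^ (2 : ℝ) := by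
    refine (hC u hu).trans ?_
    rw [hM]
    gcongr
    exact hρ.1
  calc ∫⁻ z in ball 0 ρ, ‖u z‖ₑ ^ (2 : ℝ)
      ≤ (16 * M) ^ (2 : ℝ) + C * M ^ (2 : ℝ) := (lintegral_mono_set hcover).trans
        ((lintegral_union_le _ _ _).trans (add_le_add hannulus hinterior))
    _ = _ := by
        rw [ENNReal.mul_rpow_of_nonneg _ _ zero_le_two, ENNReal.coe_add,
          ENNReal.coe_rpow_of_nonneg _ zero_le_two, add_mul]
        rfl

theorem exists_rpow_setLIntegral_sq_ball_le : ∃ C : ℝ≥0, ∀ ρ ∈ Icc (1 / 2 : ℝ) 1,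
    ∀ u : ℂ → ℝ, ContDiff ℝ 1 u → (∫⁻ z in ball 0 ρ, ‖u z‖ₑ ^ (2 : ℝ)) ^ (1 / 2 : ℝ) ≤
      C * ∫⁻ z in ball 0 ρ, (‖u z‖ₑ + ‖fderiv ℝ u z‖ₑ) := by
  obtain ⟨C, hC⟩ := exists_setLIntegral_sq_ball_le
  refine ⟨C ^ (1 / 2 : ℝ), fun ρ hρ u hu => ?_⟩
  refine (ENNReal.rpow_le_rpow (hC ρ hρ u hu) one_half_pos.le).trans_eq ?_
  rw [ENNReal.mul_rpow_of_nonneg _ _ one_half_pos.le, ← ENNReal.rpow_mul,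
    mul_one_div_cancel two_ne_zero, ENNReal.rpow_one, ENNReal.coe_rpow_of_nonneg _ one_half_pos.le]

end Gagliardo

section CriticalSobolev

open Metric
open scoped NNReal

theorem rpow_le_of_rpow_add_le_mul {S X : ℝ≥0∞} {a b : ℝ} (hS : S ≠ ⊤) (ha : 0 ≤ a) (hb : 0 < b)
    (h : S ^ (a + b) ≤ S ^ a * X) : S ^ b ≤ X := by
  rcases eq_or_ne S 0 with rfl | h0
  · rw [ENNReal.zero_rpow_of_pos hb]
    exact zero_le
  · rw [ENNReal.rpow_add _ _ h0 hS] at h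
    refine (ENNReal.mul_le_mul_iff_right ?_ (ENNReal.rpow_ne_top_of_nonneg ha hS)).1 h
    simp [ENNReal.rpow_eq_zero_iff, h0, hS]

theorem enorm_norm_rpow_add_enorm_fderiv_le {E F : Type*} [NormedAddCommGroup E] [NormedSpace ℝ E]
    [NormedAddCommGroup F] [InnerProductSpace ℝ F] {u : E → F} (hu : Differentiable ℝ u) {γ : ℝ≥0}
    (hγ : 1 < γ) (z : E) :
    ‖‖u z‖ ^ (γ : ℝ)‖ₑ + ‖fderiv ℝ (fun x => ‖u x‖ ^ (γ : ℝ)) z‖ₑ ≤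
      ‖u z‖ₑ ^ (γ - 1 : ℝ) * (‖u z‖ₑ + γ * ‖fderiv ℝ u z‖ₑ) := by
  have hγ' : (0 : ℝ) ≤ γ - 1 := sub_nonneg.2 (NNReal.coe_le_coe.2 hγ.le)
  rw [mul_add]
  refine add_le_add (le_of_eq ?_) ?_
  · conv_rhs => rw [← ENNReal.rpow_one ‖u z‖ₑ, ← ENNReal.rpow_mul, one_mul]
    rw [Real.enorm_rpow_of_nonneg (norm_nonneg _) γ.coe_nonneg, enorm_norm,
      ← ENNReal.rpow_add_of_nonneg _ _ hγ' zero_le_one, sub_add_cancel]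
  · exact (enorm_fderiv_norm_rpow_le hu hγ).trans_eq (by ring)

theorem setLIntegral_enorm_rpow_ball_ne_top {E F : Type*} [PseudoMetricSpace E] [ProperSpace E]
    [MeasurableSpace E] {μ : Measure E} [IsFiniteMeasureOnCompacts μ] [NormedAddCommGroup F]
    {u : E → F} (hu : Continuous u) (x : E) (ρ : ℝ) {s : ℝ} (hs : 0 ≤ s) :
    ∫⁻ z in ball x ρ, ‖u z‖ₑ ^ s ∂μ ≠ ⊤ := by
  obtain ⟨C, hC⟩ := (isCompact_closedBall x ρ).exists_bound_of_continuousOn hu.continuousOn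
  refine (setLIntegral_lt_top_of_le_nnreal measure_ball_lt_top.ne
    ⟨C.toNNReal ^ s, fun z hz => ?_⟩).ne
  rw [ENNReal.coe_rpow_of_nonneg _ hs, ← ofReal_norm]
  exact ENNReal.rpow_le_rpow (ENNReal.ofReal_le_ofReal (hC z (ball_subset_closedBall hz))) hs

theorem setLIntegral_norm_rpow_add_fderiv_le {u : ℂ → ℝ} (hu : ContDiff ℝ 1 u) (ρ : ℝ) {q : ℝ}
    (hq : 1 < q) {γ : ℝ≥0} (hγ : 1 < γ) :
    ∫⁻ z in ball 0 ρ, (‖‖u z‖ ^ (γ : ℝ)‖ₑ + ‖fderiv ℝ (fun x => ‖u x‖ ^ (γ : ℝ)) z‖ₑ) ≤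
      (∫⁻ z in ball 0 ρ, ‖u z‖ₑ ^ ((γ - 1) * (q / (q - 1)))) ^ (1 - 1 / q) *
        (∫⁻ z in ball 0 ρ, (‖u z‖ₑ + γ * ‖fderiv ℝ u z‖ₑ) ^ q) ^ (1 / q) := by
  have hc := hu.continuous
  have hconj : (q / (q - 1)).HolderConjugate q := (Real.HolderConjugate.conjExponent hq).symm
  refine (lintegral_mono (enorm_norm_rpow_add_enorm_fderiv_le
    (hu.differentiable one_ne_zero) hγ)).trans ?_
  refine (ENNReal.lintegral_mul_le_Lp_mul_Lq _ hconj (by fun_prop) (by fun_prop)).trans_eq ?_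
  simp only [← ENNReal.rpow_mul, one_div_div, one_sub_div (zero_lt_one.trans hq).ne']

theorem lintegral_enorm_norm_rpow_rpow {X F : Type*} [MeasurableSpace X] (μ : Measure X)
    [NormedAddCommGroup F] (u : X → F) {γ : ℝ} (hγ : 0 ≤ γ) (t : ℝ) :
    ∫⁻ z, ‖‖u z‖ ^ γ‖ₑ ^ t ∂μ = ∫⁻ z, ‖u z‖ₑ ^ (γ * t) ∂μ :=
  lintegral_congr fun z => by
    rw [Real.enorm_rpow_of_nonneg (norm_nonneg _) hγ, enorm_norm, ← ENNReal.rpow_mul]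

/- Gagliardo's inequality for `|u| ^ (s / 2)` and Hölder's inequality give
`S ^ (1 / 2) ≤ C S ^ (1 - 1 / q) X`, where `S` is the integral of `|u| ^ s` and `1 / s` is the
difference of the two exponents of `S`. -/
theorem rpow_setLIntegral_critical_ball_le_of_sq {C : ℝ≥0} {ρ : ℝ}
    (hC : ∀ u : ℂ → ℝ, ContDiff ℝ 1 u → (∫⁻ z in ball 0 ρ, ‖u z‖ₑ ^ (2 : ℝ)) ^ (1 / 2 : ℝ) ≤
      C * ∫⁻ z in ball 0 ρ, (‖u z‖ₑ + ‖fderiv ℝ u z‖ₑ))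
    {q : ℝ} (hq : q ∈ Ioo 1 2) {s : ℝ≥0} (hs : s = 2 * q / (2 - q)) {u : ℂ → ℝ}
    (hu : ContDiff ℝ 1 u) :
    (∫⁻ z in ball 0 ρ, ‖u z‖ₑ ^ (s : ℝ)) ^ (1 / s : ℝ) ≤
      C * (∫⁻ z in ball 0 ρ, (‖u z‖ₑ + (s / 2 : ℝ≥0) * ‖fderiv ℝ u z‖ₑ) ^ q) ^ (1 / q) := by
  obtain ⟨hq1, hq2⟩ := hq
  have h2q : 0 < 2 - q := by linarith
  have hs0 : 0 < (s : ℝ) := by rw [hs]; positivity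
  have hγ : 1 < s / 2 := by
    rw [← NNReal.coe_lt_coe]
    push_cast
    rw [hs, mul_div_assoc, mul_div_cancel_left₀ _ two_ne_zero, one_lt_div h2q]
    linarith
  have hexp : (((s / 2 : ℝ≥0) : ℝ) - 1) * (q / (q - 1)) = s := by
    have : q - 1 ≠ 0 := by linarith
    push_cast
    rw [hs]
    field_simp
    ring
  have hsq : ∫⁻ z in ball 0 ρ, ‖‖u z‖ ^ ((s / 2 : ℝ≥0) : ℝ)‖ₑ ^ (2 : ℝ) =
      ∫⁻ z in ball 0 ρ, ‖u z‖ₑ ^ (s : ℝ) := by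
    rw [lintegral_enorm_norm_rpow_rpow _ u (NNReal.coe_nonneg _), NNReal.coe_div,
      NNReal.coe_ofNat, div_mul_cancel₀ _ two_ne_zero]
  have hgagliardo := hsq ▸ hC _ (hu.norm_rpow hγ)
  have hHolder := setLIntegral_norm_rpow_add_fderiv_le hu ρ hq1 hγ
  rw [hexp] at hHolder
  set S := ∫⁻ z in ball 0 ρ, ‖u z‖ₑ ^ (s : ℝ)
  refine rpow_le_of_rpow_add_le_mul (a := 1 - 1 / q)
    (setLIntegral_enorm_rpow_ball_ne_top hu.continuous 0 ρ hs0.le)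
    (sub_nonneg.2 ((div_le_one (by positivity)).2 hq1.le)) (by positivity) ?_
  calc S ^ (1 - 1 / q + 1 / s) = S ^ (1 / 2 : ℝ) := by
        congr 1
        rw [hs]
        field_simp
        ring
    _ ≤ C * (S ^ (1 - 1 / q) *
        (∫⁻ z in ball 0 ρ, (‖u z‖ₑ + (s / 2 : ℝ≥0) * ‖fderiv ℝ u z‖ₑ) ^ q) ^ (1 / q)) :=
        hgagliardo.trans (by gcongr; exact hHolder)
    _ = _ := mul_left_comm _ _ _

theorem exists_rpow_setLIntegral_critical_ball_le : ∃ C : ℝ≥0, ∀ ρ ∈ Icc (1 / 2 : ℝ) 1,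
    ∀ q ∈ Ico (1 : ℝ) 2, ∀ s : ℝ≥0, s = 2 * q / (2 - q) → ∀ u : ℂ → ℝ, ContDiff ℝ 1 u →
      (∫⁻ z in ball 0 ρ, ‖u z‖ₑ ^ (s : ℝ)) ^ (1 / s : ℝ) ≤
        C * (∫⁻ z in ball 0 ρ, (‖u z‖ₑ + (s / 2 : ℝ≥0) * ‖fderiv ℝ u z‖ₑ) ^ q) ^ (1 / q) := by
  obtain ⟨C, hC⟩ := exists_rpow_setLIntegral_sq_ball_le
  refine ⟨C, fun ρ hρ q ⟨hq1, hq2⟩ s hs u hu => ?_⟩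
  rcases hq1.eq_or_lt with rfl | hq1
  · obtain rfl : s = 2 := by ext; rw [hs]; norm_num
    simpa using hC ρ hρ u hu
  · exact rpow_setLIntegral_critical_ball_le_of_sq (hC ρ hρ) ⟨hq1, hq2⟩ hs hu

end CriticalSobolev

section Poincare

open Metric Module

theorem lintegral_rpow_le_lintegral_rpow {X : Type*} [MeasurableSpace X] {μ : Measure X}
    [IsProbabilityMeasure μ] {f : X → ℝ≥0∞} (hf : AEMeasurable f μ) {q : ℝ} (hq : 1 ≤ q) :
    (∫⁻ x, f x ∂μ) ^ q ≤ ∫⁻ x, f x ^ q ∂μ := by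
  have hq0 : 0 < q := zero_lt_one.trans_le hq
  have h := ENNReal.rpow_le_rpow
    (eLpNorm'_le_eLpNorm'_of_exponent_le zero_lt_one hq μ hf.aestronglyMeasurable) hq0.le
  simpa [eLpNorm', ← ENNReal.rpow_mul, inv_mul_cancel₀ hq0.ne'] using h

variable {E F : Type*} [NormedAddCommGroup E] [NormedSpace ℝ E] [NormedAddCommGroup F]
  [NormedSpace ℝ F]

theorem enorm_sub_rpow_le_lintegral_segment {u : E → F} (hu : ContDiff ℝ 1 u) {q : ℝ} (hq : 1 ≤ q)
    (x y : E) :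
    ‖u x - u y‖ₑ ^ q ≤
      edist x y ^ q * ∫⁻ t in Icc (0 : ℝ) 1, ‖fderiv ℝ u ((1 - t) • x + t • y)‖ₑ ^ q := by
  have hq0 : 0 ≤ q := zero_le_one.trans hq
  have hu' := hu.continuous_fderiv one_ne_zero
  have hderiv (t : ℝ) : deriv (fun t : ℝ => u ((1 - t) • x + t • y)) t =
      fderiv ℝ u ((1 - t) • x + t • y) (y - x) := by
    refine ((hu.differentiable one_ne_zero _).hasFDerivAt.comp_hasDerivAt t ?_).deriv
    exact ((((hasDerivAt_id t).const_sub 1).smul_const x).add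
      ((hasDerivAt_id t).smul_const y)).congr_deriv (by module)
  have : IsProbabilityMeasure (volume.restrict (Icc (0 : ℝ) 1)) := ⟨by simp⟩
  have hline : ‖u x - u y‖ₑ ≤
      ∫⁻ t in Icc (0 : ℝ) 1, ‖fderiv ℝ u ((1 - t) • x + t • y) (y - x)‖ₑ := by
    simpa [hderiv, enorm_sub_rev (u y)] using enorm_sub_le_lintegral_deriv_of_contDiffOn_Icc
      (f := fun t : ℝ => u ((1 - t) • x + t • y))
      (hu.comp (by fun_prop)).contDiffOn (zero_le_one' ℝ)
  calc ‖u x - u y‖ₑ ^ q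
      ≤ (∫⁻ t in Icc (0 : ℝ) 1, edist x y * ‖fderiv ℝ u ((1 - t) • x + t • y)‖ₑ) ^ q := by
        gcongr
        refine hline.trans (lintegral_mono fun t => ?_)
        rw [edist_comm, edist_eq_enorm_sub, mul_comm]
        exact ContinuousLinearMap.le_opENorm _ _
    _ = edist x y ^ q * (∫⁻ t in Icc (0 : ℝ) 1, ‖fderiv ℝ u ((1 - t) • x + t • y)‖ₑ) ^ q := by
        rw [lintegral_const_mul' _ _ (edist_ne_top x y), ENNReal.mul_rpow_of_nonneg _ _ hq0]
    _ ≤ _ := by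
        gcongr
        exact lintegral_rpow_le_lintegral_rpow
          (hu'.comp (by fun_prop)).enorm.measurable.aemeasurable hq

variable [FiniteDimensional ℝ E] [MeasurableSpace E] [BorelSpace E] (μ : Measure E)
  [μ.IsAddHaarMeasure] {f : E → ℝ≥0∞}

theorem lintegral_comp_add_smul (hf : Measurable f) {a : ℝ} (ha : a ≠ 0) (b : E) :
    ∫⁻ x, f (b + a • x) ∂μ = ENNReal.ofReal |(a ^ finrank ℝ E)⁻¹| * ∫⁻ x, f x ∂μ :=
  calc ∫⁻ x, f (b + a • x) ∂μ = ∫⁻ y, f (b + y) ∂(μ.map (a • ·)) :=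
        (lintegral_map (hf.comp (measurable_const_add b)) (measurable_const_smul a)).symm
    _ = _ := by
        rw [Measure.map_addHaar_smul μ ha, lintegral_smul_measure, lintegral_add_left_eq_self,
          smul_eq_mul]

theorem lintegral_lintegral_add_smul_le (hf : Measurable f) (s : Set E) (a : ℝ) {b : ℝ}
    (hb : 1 / 2 ≤ b) :
    ∫⁻ x in s, ∫⁻ y in s, f (a • x + b • y) ∂μ ∂μ ≤ 2 ^ finrank ℝ E * μ s * ∫⁻ z, f z ∂μ := by
  have hb0 : 0 < b := by linarith
  have hjac : ENNReal.ofReal |(b ^ finrank ℝ E)⁻¹| ≤ 2 ^ finrank ℝ E := by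
    rw [abs_of_nonneg (by positivity), ← inv_pow, ENNReal.ofReal_pow (by positivity)]
    gcongr
    exact ENNReal.ofReal_le_of_le_toReal (by simpa using inv_anti₀ (by norm_num) hb)
  calc ∫⁻ x in s, ∫⁻ y in s, f (a • x + b • y) ∂μ ∂μ
      ≤ ∫⁻ _ in s, 2 ^ finrank ℝ E * ∫⁻ z, f z ∂μ ∂μ := by
        refine lintegral_mono fun x => (setLIntegral_le_lintegral _ _).trans ?_
        rw [lintegral_comp_add_smul μ hf hb0.ne']
        gcongr
    _ = _ := by rw [setLIntegral_const, mul_right_comm]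

/- One of `t`, `1 - t` is at least `1 / 2`; substituting in the corresponding variable costs a
Jacobian of at most `2 ^ dim E`. -/
theorem lintegral_lintegral_segment_le (hf : Measurable f) (s : Set E) (t : ℝ) :
    ∫⁻ x in s, ∫⁻ y in s, f ((1 - t) • x + t • y) ∂μ ∂μ ≤
      2 ^ finrank ℝ E * μ s * ∫⁻ z, f z ∂μ := by
  rcases le_total (1 / 2) t with ht | ht
  · exact lintegral_lintegral_add_smul_le μ hf s (1 - t) ht
  · have hm : Measurable (Function.uncurry fun x y => f ((1 - t) • x + t • y)) :=
      hf.comp (by fun_prop)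
    rw [lintegral_lintegral_swap hm.aemeasurable]
    simp_rw [add_comm ((1 - t) • _)]
    exact lintegral_lintegral_add_smul_le μ hf s t (by linarith)

theorem lintegral_lintegral_lintegral_segment_le (hf : Measurable f) (s : Set E) :
    ∫⁻ x in s, ∫⁻ y in s, (∫⁻ t in Icc (0 : ℝ) 1, f ((1 - t) • x + t • y)) ∂μ ∂μ ≤
      2 ^ finrank ℝ E * μ s * ∫⁻ z, f z ∂μ :=
  calc ∫⁻ x in s, ∫⁻ y in s, (∫⁻ t in Icc (0 : ℝ) 1, f ((1 - t) • x + t • y)) ∂μ ∂μ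
      = ∫⁻ x in s, (∫⁻ t in Icc (0 : ℝ) 1, ∫⁻ y in s, f ((1 - t) • x + t • y) ∂μ) ∂μ :=
        lintegral_congr fun x => lintegral_lintegral_swap
          (Measurable.comp (g := f) hf (by fun_prop)).aemeasurable
    _ = ∫⁻ t in Icc (0 : ℝ) 1, ∫⁻ x in s, ∫⁻ y in s, f ((1 - t) • x + t • y) ∂μ ∂μ := by
        refine lintegral_lintegral_swap (Measurable.aemeasurable ?_)
        exact Measurable.lintegral_prod_right'
          (f := fun z : (E × ℝ) × E => f ((1 - z.1.2) • z.1.1 + z.1.2 • z.2))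
          (hf.comp (by fun_prop))
    _ ≤ ∫⁻ _ in Icc (0 : ℝ) 1, 2 ^ finrank ℝ E * μ s * ∫⁻ z, f z ∂μ :=
        lintegral_mono fun t => lintegral_lintegral_segment_le μ hf s t
    _ = _ := by simp

theorem lintegral_lintegral_enorm_sub_rpow_le {u : E → F} (hu : ContDiff ℝ 1 u) {q : ℝ}
    (hq : 1 ≤ q) {s : Set E} (hs : Convex ℝ s) (hsm : MeasurableSet s) :
    ∫⁻ x in s, ∫⁻ y in s, ‖u x - u y‖ₑ ^ q ∂μ ∂μ ≤
      ediam s ^ q * (2 ^ finrank ℝ E * μ s * ∫⁻ z in s, ‖fderiv ℝ u z‖ₑ ^ q ∂μ) := by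
  have hu' := hu.continuous_fderiv one_ne_zero
  set f : E → ℝ≥0∞ := s.indicator fun z => ‖fderiv ℝ u z‖ₑ ^ q
  have hf : Measurable f := Measurable.indicator (hu'.enorm.measurable.pow_const q) hsm
  have hsegment (x : E) (hx : x ∈ s) (y : E) (hy : y ∈ s) : ‖u x - u y‖ₑ ^ q ≤
      ediam s ^ q * ∫⁻ t in Icc (0 : ℝ) 1, f ((1 - t) • x + t • y) := by
    refine (enorm_sub_rpow_le_lintegral_segment hu hq x y).trans ?_
    refine mul_le_mul'
      (ENNReal.rpow_le_rpow (edist_le_ediam_of_mem hx hy) (zero_le_one.trans hq))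
      (setLIntegral_congr_fun measurableSet_Icc fun t ht => ?_).le
    exact (indicator_of_mem (hs hx hy (sub_nonneg.2 ht.2) ht.1 (sub_add_cancel 1 t))
      fun z => ‖fderiv ℝ u z‖ₑ ^ q).symm
  calc ∫⁻ x in s, ∫⁻ y in s, ‖u x - u y‖ₑ ^ q ∂μ ∂μ
      ≤ ∫⁻ x in s, ∫⁻ y in s,
          ediam s ^ q * (∫⁻ t in Icc (0 : ℝ) 1, f ((1 - t) • x + t • y)) ∂μ ∂μ :=
        setLIntegral_mono' hsm fun x hx => setLIntegral_mono' hsm fun y hy => hsegment x hx y hy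
    _ = ediam s ^ q *
          ∫⁻ x in s, ∫⁻ y in s, (∫⁻ t in Icc (0 : ℝ) 1, f ((1 - t) • x + t • y)) ∂μ ∂μ := by
        have hm : Measurable fun z : (E × E) => ∫⁻ t in Icc (0 : ℝ) 1,
            f ((1 - t) • z.1 + t • z.2) :=
          Measurable.lintegral_prod_right'
            (f := fun w : (E × E) × ℝ => f ((1 - w.2) • w.1.1 + w.2 • w.1.2))
            (hf.comp (by fun_prop))
        rw [← lintegral_const_mul _ (Measurable.lintegral_prod_right' hm)]
        exact lintegral_congr fun x => lintegral_const_mul _ (hm.comp measurable_prodMk_left)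
    _ ≤ _ := by
        gcongr
        exact (lintegral_lintegral_lintegral_segment_le μ hf s).trans_eq
          (by rw [lintegral_indicator hsm])

end Poincare

section Young

variable {G : Type*} [MeasurableSpace G] [AddCommGroup G] [MeasurableAdd₂ G] [MeasurableNeg G]
  {μ : Measure G} [SFinite μ] [μ.IsAddLeftInvariant] [μ.IsNegInvariant]

theorem lintegral_rpow_lintegral_mul_sub_le {κ f : G → ℝ≥0∞} (hκ : Measurable κ)
    (hκ1 : ∫⁻ x, κ x ∂μ = 1) (hf : AEMeasurable f μ) {q : ℝ} (hq : 1 ≤ q) :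
    ∫⁻ x, (∫⁻ t, κ (x - t) * f t ∂μ) ^ q ∂μ ≤ ∫⁻ t, f t ^ q ∂μ := by
  have hjensen (x : G) :
      (∫⁻ t, κ (x - t) * f t ∂μ) ^ q ≤ ∫⁻ t, κ (x - t) * f t ^ q ∂μ := by
    have hκx : AEMeasurable (fun t => κ (x - t)) μ := by fun_prop
    have : IsProbabilityMeasure (μ.withDensity fun t => κ (x - t)) :=
      ⟨by rw [withDensity_apply _ .univ, Measure.restrict_univ, lintegral_sub_left_eq_self, hκ1]⟩
    have h := lintegral_rpow_le_lintegral_rpow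
      (hf.mono_ac (withDensity_absolutelyContinuous μ fun t => κ (x - t))) hq
    rwa [lintegral_withDensity_eq_lintegral_mul₀ hκx hf,
      lintegral_withDensity_eq_lintegral_mul₀ hκx (hf.pow_const q)] at h
  calc ∫⁻ x, (∫⁻ t, κ (x - t) * f t ∂μ) ^ q ∂μ
      ≤ ∫⁻ x, ∫⁻ t, κ (x - t) * f t ^ q ∂μ ∂μ := lintegral_mono hjensen
    _ = ∫⁻ t, ∫⁻ x, κ (x - t) * f t ^ q ∂μ ∂μ := by
        refine lintegral_lintegral_swap (AEMeasurable.mul (by fun_prop) ?_)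
        exact (hf.pow_const q).comp_quasiMeasurePreserving Measure.quasiMeasurePreserving_snd
    _ = ∫⁻ t, f t ^ q ∂μ := by
        refine lintegral_congr fun t => ?_
        rw [lintegral_mul_const _ (by fun_prop), lintegral_sub_right_eq_self κ, hκ1, one_mul]

end Young

section Mollification

open Metric Filter Topology
open scoped Convolution
open ContinuousLinearMap (lsmul)

theorem lintegral_enorm_indicator_rpow {X E : Type*} [MeasurableSpace X] {μ : Measure X}
    [NormedAddCommGroup E] {s : Set X} (hs : MeasurableSet s) {q : ℝ} (hq : 0 < q) (f : X → E) :
    ∫⁻ x, ‖s.indicator f x‖ₑ ^ q ∂μ = ∫⁻ x in s, ‖f x‖ₑ ^ q ∂μ := by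
  rw [← lintegral_indicator hs]
  congr with x
  by_cases hx : x ∈ s <;> simp [hx, hq]

/-- The mollification of `w` at the scale of the bump function `k`. -/
noncomputable def mollify (k : ContDiffBump (0 : ℂ)) (w : ℂ → ℝ) : ℂ → ℝ :=
  k.normed volume ⋆[lsmul ℝ ℝ, volume] w

variable (k : ContDiffBump (0 : ℂ)) {Ω s : Set ℂ} {u w : ℂ → ℝ} {H : ℂ → ℂ} {q : ℝ} {x : ℂ}

theorem contDiff_mollify (hw : LocallyIntegrable w) : ContDiff ℝ 1 (mollify k w) :=
  k.hasCompactSupport_normed.contDiff_convolution_left (n := 1) _ k.contDiff_normed hw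

theorem mollify_apply (w : ℂ → ℝ) (x : ℂ) :
    mollify k w x = ∫ t, k.normed volume (x - t) * w t := by
  rw [mollify, convolution_eq_swap]
  rfl

theorem fderiv_mollify_apply (hw : LocallyIntegrable w) (x v : ℂ) :
    fderiv ℝ (mollify k w) x v = ∫ t, fderiv ℝ (k.normed volume) (x - t) v * w t := by
  have hk : ContDiff ℝ 1 (k.normed (volume : Measure ℂ)) := k.contDiff_normed
  rw [mollify,
    (k.hasCompactSupport_normed.hasFDerivAt_convolution_left (lsmul ℝ ℝ) hk hw x).fderiv,
    convolution_eq_swap, ContinuousLinearMap.integral_apply]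
  · rfl
  · exact ((k.hasCompactSupport_normed.fderiv ℝ).convolutionExists_left _
      (hk.continuous_fderiv one_ne_zero) hw x).integrable_swap

theorem lintegral_enorm_normed : ∫⁻ x, ‖k.normed volume x‖ₑ = 1 := by
  rw [← ofReal_integral_norm_eq_lintegral_enorm k.integrable_normed]
  simp_rw [Real.norm_of_nonneg (k.nonneg_normed _)]
  rw [k.integral_normed, ENNReal.ofReal_one]

theorem lintegral_rpow_lintegral_normed_le {f : ℂ → ℝ≥0∞} (hf : AEMeasurable f) (hq : 1 ≤ q) :
    ∫⁻ x, (∫⁻ t, ‖k.normed volume (x - t)‖ₑ * f t) ^ q ≤ ∫⁻ t, f t ^ q :=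
  lintegral_rpow_lintegral_mul_sub_le (κ := fun x => ‖k.normed volume x‖ₑ)
    k.continuous_normed.enorm.measurable (lintegral_enorm_normed k) hf hq

theorem lintegral_enorm_mollify_rpow_le (hw : AEStronglyMeasurable w) (hq : 1 ≤ q) :
    ∫⁻ x, ‖mollify k w x‖ₑ ^ q ≤ ∫⁻ x, ‖w x‖ₑ ^ q := by
  refine (lintegral_mono fun x => ENNReal.rpow_le_rpow ?_ (zero_le_one.trans hq)).trans
    (lintegral_rpow_lintegral_normed_le k hw.enorm hq)
  rw [mollify_apply]
  simpa only [enorm_mul] using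
    enorm_integral_le_lintegral_enorm fun t => k.normed volume (x - t) * w t

theorem tsupport_normed_sub_subset (x : ℂ) :
    tsupport (fun t => k.normed volume (x - t)) ⊆ closedBall x k.rOut := by
  refine closure_minimal (fun t ht => ?_) isClosed_closedBall
  have hxt : x - t ∈ Function.support (k.normed (volume : Measure ℂ)) := ht
  rw [k.support_normed_eq, mem_ball_zero_iff, ← dist_eq_norm, dist_comm] at hxt
  exact hxt.le

theorem fderiv_mollify_indicator_apply (hu : HasWeakGradientOn Ω u H) (hΩ : MeasurableSet Ω)
    (hs : MeasurableSet s) (hsΩ : s ⊆ Ω) (hus : IntegrableOn u s)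
    (hx : closedBall x k.rOut ⊆ s) (v : ℂ) :
    fderiv ℝ (mollify k (s.indicator u)) x v =
      ∫ t, k.normed volume (x - t) * inner ℝ (s.indicator H t) v := by
  have hk : ContDiff ℝ ∞ (k.normed (volume : Measure ℂ)) := k.contDiff_normed
  set η := fun t => k.normed volume (x - t)
  have hηs : tsupport η ⊆ s := (tsupport_normed_sub_subset k x).trans hx
  have hηc : HasCompactSupport η := (isCompact_closedBall x k.rOut).of_isClosed_subset
    (isClosed_tsupport _) (tsupport_normed_sub_subset k x)
  have hη' (t : ℂ) : fderiv ℝ η t v = -fderiv ℝ (k.normed volume) (x - t) v := by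
    have h : HasFDerivAt η _ t := ((hk.differentiable (by simp)) (x - t)).hasFDerivAt.comp t
      ((hasFDerivAt_id (𝕜 := ℝ) t).const_sub x)
    simp [h.fderiv]
  calc fderiv ℝ (mollify k (s.indicator u)) x v
      = ∫ t, fderiv ℝ (k.normed volume) (x - t) v * s.indicator u t :=
        fderiv_mollify_apply k (hus.integrable_indicator hs).locallyIntegrable x v
    _ = -∫ t in s, u t * fderiv ℝ η t v := by
        rw [← integral_neg, ← integral_indicator hs]
        congr with t
        by_cases ht : t ∈ s <;> simp [ht, hη', mul_comm]
    _ = -∫ t in Ω, u t * fderiv ℝ η t v := by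
        rw [setIntegral_eq_of_subset_of_forall_sdiff_eq_zero hΩ hsΩ]
        intro t ht
        rw [image_eq_zero_of_notMem_tsupport fun h => ht.2 (hηs (tsupport_fderiv_subset ℝ h))]
        simp
    _ = ∫ t in Ω, inner ℝ (H t) v * η t := by
        rw [hu.2.2 η (hk.comp (by fun_prop)) hηc (hηs.trans hsΩ) v, neg_neg]
    _ = ∫ t in s, inner ℝ (H t) v * η t := by
        refine setIntegral_eq_of_subset_of_forall_sdiff_eq_zero hΩ hsΩ fun t ht => ?_
        rw [image_eq_zero_of_notMem_tsupport fun h => ht.2 (hηs h), mul_zero]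
    _ = _ := by
        rw [← integral_indicator hs]
        congr with t
        by_cases ht : t ∈ s <;> simp [ht, η, mul_comm]

theorem enorm_fderiv_mollify_indicator_le (hu : HasWeakGradientOn Ω u H) (hΩ : MeasurableSet Ω)
    (hs : MeasurableSet s) (hsΩ : s ⊆ Ω) (hus : IntegrableOn u s)
    (hx : closedBall x k.rOut ⊆ s) :
    ‖fderiv ℝ (mollify k (s.indicator u)) x‖ₑ ≤
      ∫⁻ t, ‖k.normed volume (x - t)‖ₑ * ‖s.indicator H t‖ₑ := by
  refine ContinuousLinearMap.opENorm_le_bound _ fun v => ?_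
  rw [fderiv_mollify_indicator_apply k hu hΩ hs hsΩ hus hx, ← lintegral_mul_const' _ _ enorm_ne_top]
  refine (enorm_integral_le_lintegral_enorm _).trans (lintegral_mono fun t => ?_)
  rw [enorm_mul, mul_assoc]
  gcongr
  simpa only [enorm_eq_nnnorm, ← ENNReal.coe_mul, ENNReal.coe_le_coe] using
    nnnorm_inner_le_nnnorm (𝕜 := ℝ) (s.indicator H t) v

theorem setLIntegral_enorm_fderiv_mollify_indicator_rpow_le (hu : HasWeakGradientOn Ω u H)
    (hΩ : MeasurableSet Ω) (hs : MeasurableSet s) (hsΩ : s ⊆ Ω) (hus : IntegrableOn u s)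
    (hH : AEStronglyMeasurable (s.indicator H)) {A : Set ℂ} (hA : MeasurableSet A)
    (hAs : ∀ x ∈ A, closedBall x k.rOut ⊆ s) (hq : 1 ≤ q) :
    ∫⁻ x in A, ‖fderiv ℝ (mollify k (s.indicator u)) x‖ₑ ^ q ≤ ∫⁻ x in s, ‖H x‖ₑ ^ q := by
  have hq0 : 0 < q := zero_lt_one.trans_le hq
  calc ∫⁻ x in A, ‖fderiv ℝ (mollify k (s.indicator u)) x‖ₑ ^ q
      ≤ ∫⁻ x in A, (∫⁻ t, ‖k.normed volume (x - t)‖ₑ * ‖s.indicator H t‖ₑ) ^ q :=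
        setLIntegral_mono' hA fun x hx => ENNReal.rpow_le_rpow
          (enorm_fderiv_mollify_indicator_le k hu hΩ hs hsΩ hus (hAs x hx)) hq0.le
    _ ≤ ∫⁻ x, (∫⁻ t, ‖k.normed volume (x - t)‖ₑ * ‖s.indicator H t‖ₑ) ^ q :=
        setLIntegral_le_lintegral _ _
    _ ≤ ∫⁻ t, ‖s.indicator H t‖ₑ ^ q := lintegral_rpow_lintegral_normed_le k hH.enorm hq
    _ = _ := lintegral_enorm_indicator_rpow hs hq0 H

end Mollification

section Approximation

open Metric Filter Topology

theorem lintegral_le_of_ae_tendsto {X : Type*} [MeasurableSpace X] {μ : Measure X}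
    {f : ℕ → X → ℝ≥0∞} {g : X → ℝ≥0∞} {M : ℝ≥0∞} (hf : ∀ n, AEMeasurable (f n) μ)
    (hfg : ∀ᵐ x ∂μ, Tendsto (fun n => f n x) atTop (𝓝 (g x))) (hM : ∀ n, ∫⁻ x, f n x ∂μ ≤ M) :
    ∫⁻ x, g x ∂μ ≤ M :=
  calc ∫⁻ x, g x ∂μ = ∫⁻ x, liminf (fun n => f n x) atTop ∂μ :=
        lintegral_congr_ae (hfg.mono fun _ hx => hx.liminf_eq.symm)
    _ ≤ liminf (fun n => ∫⁻ x, f n x ∂μ) atTop := lintegral_liminf_le' hf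
    _ ≤ liminf (fun _ => M) (atTop : Filter ℕ) := liminf_le_liminf (Eventually.of_forall hM)
    _ = M := liminf_const M

theorem setLIntegral_ball_le_of_forall_lt {X : Type*} [PseudoMetricSpace X] [MeasurableSpace X]
    {μ : Measure X} {g : X → ℝ≥0∞} {M : ℝ≥0∞} {x : X} {a R : ℝ} (haR : a < R)
    (h : ∀ ρ ∈ Ioo a R, ∫⁻ z in ball x ρ, g z ∂μ ≤ M) : ∫⁻ z in ball x R, g z ∂μ ≤ M := by
  obtain ⟨ρ, hρmono, hρ, hρR⟩ := exists_seq_strictMono_tendsto' haR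
  have hball : ball x R = ⋃ n, ball x (ρ n) := by
    ext z
    simp only [mem_iUnion, mem_ball]
    exact ⟨fun hz => (hρR.eventually_const_lt hz).exists, fun ⟨n, hn⟩ => hn.trans (hρ n).2⟩
  have hmono : Monotone fun n => ball x (ρ n) := fun _ _ h => ball_subset_ball (hρmono.monotone h)
  rw [hball, setLIntegral_iUnion_of_directed _ hmono.directed_le]
  exact iSup_le fun n => h _ (hρ n)

theorem exists_seq_contDiffBump_rOut_tendsto {δ : ℝ} (hδ : 0 < δ) :
    ∃ k : ℕ → ContDiffBump (0 : ℂ), (∀ n, (k n).rOut ≤ δ) ∧ (∀ n, (k n).rOut ≤ 2 * (k n).rIn) ∧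
      Tendsto (fun n => (k n).rOut) atTop (𝓝 0) := by
  refine ⟨fun n => ⟨δ / (n + 1) / 2, δ / (n + 1), by positivity, half_lt_self (by positivity)⟩,
    fun n => div_le_self hδ.le (by simp), fun n => (mul_div_cancel₀ _ two_ne_zero).ge, ?_⟩
  exact ((tendsto_const_div_atTop_nhds_zero_nat δ).comp (tendsto_add_atTop_nat 1)).congr
    fun n => by simp

theorem HasWeakGradientOn.exists_seq_contDiff_tendsto {Ω s : Set ℂ} {u : ℂ → ℝ} {H : ℂ → ℂ}
    (hu : HasWeakGradientOn Ω u H) (hΩ : IsOpen Ω) (hs : MeasurableSet s)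
    (hsc : IsCompact (closure s)) (hsΩ : closure s ⊆ Ω) {q : ℝ} (hq : 1 ≤ q) :
    ∃ U : ℕ → ℂ → ℝ, (∀ n, ContDiff ℝ 1 (U n)) ∧
      (∀ n, ∫⁻ x in s, ‖U n x‖ₑ ^ q ≤ ∫⁻ x in Ω, ‖u x‖ₑ ^ q) ∧
      (∀ n, ∫⁻ x in s, ‖fderiv ℝ (U n) x‖ₑ ^ q ≤ ∫⁻ x in Ω, ‖H x‖ₑ ^ q) ∧
      ∀ᵐ x ∂volume.restrict s, Tendsto (fun n => U n x) atTop (𝓝 (u x)) := by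
  have hq0 : 0 < q := zero_lt_one.trans_le hq
  obtain ⟨δ, hδ, hδΩ⟩ := hsc.exists_cthickening_subset_open hΩ hsΩ
  set K := cthickening δ (closure s)
  have hK : IsCompact K := hsc.cthickening
  have hKm : MeasurableSet K := hK.measurableSet
  have huK : IntegrableOn u K :=
    (locallyIntegrableOn_iff hΩ.isLocallyClosed).1 hu.1 K hδΩ hK
  have hHK : IntegrableOn H K :=
    (locallyIntegrableOn_iff hΩ.isLocallyClosed).1 hu.2.1 K hδΩ hK
  have hw := huK.integrable_indicator hKm
  obtain ⟨k, hkδ, hk2, hk0⟩ := exists_seq_contDiffBump_rOut_tendsto hδ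
  have hball (n : ℕ) (x : ℂ) (hx : x ∈ s) : closedBall x (k n).rOut ⊆ K :=
    (closedBall_subset_closedBall (hkδ n)).trans
      (closedBall_subset_cthickening (subset_closure hx) δ)
  refine ⟨fun n => mollify (k n) (K.indicator u), fun n => contDiff_mollify _ hw.locallyIntegrable,
    fun n => ?_, fun n => ?_, ?_⟩
  · calc ∫⁻ x in s, ‖mollify (k n) (K.indicator u) x‖ₑ ^ q
        ≤ ∫⁻ x, ‖K.indicator u x‖ₑ ^ q := (setLIntegral_le_lintegral _ _).trans
          (lintegral_enorm_mollify_rpow_le _ hw.aestronglyMeasurable hq)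
      _ = ∫⁻ x in K, ‖u x‖ₑ ^ q := lintegral_enorm_indicator_rpow hKm hq0 u
      _ ≤ _ := lintegral_mono_set hδΩ
  · exact (setLIntegral_enorm_fderiv_mollify_indicator_rpow_le (k n) hu hΩ.measurableSet hKm hδΩ
      huK (hHK.integrable_indicator hKm).aestronglyMeasurable hs (hball n) hq).trans
      (lintegral_mono_set hδΩ)
  · rw [ae_restrict_iff' hs]
    filter_upwards [ContDiffBump.ae_convolution_tendsto_right_of_locallyIntegrable hk0
      (Eventually.of_forall hk2) hw.locallyIntegrable] with x hx hxs
    rwa [indicator_of_mem (self_subset_cthickening _ (subset_closure hxs))] at hx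

end Approximation

section Ball

open Metric Filter Topology Module
open scoped NNReal

variable {u : ℂ → ℝ} {H : ℂ → ℂ} {x : ℂ} {R q : ℝ}

theorem HasWeakGradientOn.setLIntegral_prod_enorm_sub_rpow_ball_le
    (hu : HasWeakGradientOn (ball x R) u H) (hq : 1 ≤ q) :
    ∫⁻ z in ball x R ×ˢ ball x R, ‖u z.1 - u z.2‖ₑ ^ q ≤
      ediam (ball x R) ^ q * (4 * volume (ball x R) * ∫⁻ z in ball x R, ‖H z‖ₑ ^ q) := by
  rw [ball_prod_same]
  refine setLIntegral_ball_le_of_forall_lt (sub_one_lt R) fun ρ hρ => ?_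
  rw [← ball_prod_same]
  have hsubset : ball x ρ ⊆ ball x R := ball_subset_ball hρ.2.le
  obtain ⟨U, hU, -, hUH, hlim⟩ := hu.exists_seq_contDiff_tendsto isOpen_ball measurableSet_ball
    isBounded_ball.isCompact_closure
    (closure_ball_subset_closedBall.trans (closedBall_subset_ball hρ.2)) hq
  have hcont (n : ℕ) : Continuous fun z : ℂ × ℂ => ‖U n z.1 - U n z.2‖ₑ ^ q := by
    have := (hU n).continuous
    exact ENNReal.continuous_rpow_const.comp (by fun_prop)
  rw [Measure.volume_eq_prod]
  refine lintegral_le_of_ae_tendsto (fun n => (hcont n).aemeasurable) ?_ fun n => ?_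
  · rw [← Measure.prod_restrict]
    filter_upwards [Measure.quasiMeasurePreserving_fst.ae hlim,
      Measure.quasiMeasurePreserving_snd.ae hlim] with z h1 h2
    exact (ENNReal.continuous_rpow_const.tendsto _).comp (h1.sub h2).enorm
  · rw [setLIntegral_prod _ (hcont n).aemeasurable]
    refine (lintegral_lintegral_enorm_sub_rpow_le volume (hU n) hq (convex_ball x ρ)
      measurableSet_ball).trans ?_
    rw [Complex.finrank_real_complex]
    norm_num only
    exact mul_le_mul' (ENNReal.rpow_le_rpow (ediam_mono hsubset) (zero_le_one.trans hq))
      (mul_le_mul' (mul_le_mul' le_rfl (measure_mono hsubset)) (hUH n))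

theorem HasWeakGradientOn.exists_setLIntegral_enorm_sub_const_rpow_ball_le
    (hu : HasWeakGradientOn (ball x R) u H) (hR : 0 < R) (hq : 1 ≤ q) :
    ∃ c : ℝ, ∫⁻ z in ball x R, ‖u z - c‖ₑ ^ q ≤
      ediam (ball x R) ^ q * (4 * ∫⁻ z in ball x R, ‖H z‖ₑ ^ q) := by
  have hum : AEMeasurable u (volume.restrict (ball x R)) := hu.1.aestronglyMeasurable.aemeasurable
  set μ := (volume : Measure ℂ).restrict (ball x R) with hμ
  have : IsFiniteMeasure μ :=
    ⟨by simpa [hμ] using measure_ball_lt_top (μ := volume) (x := x) (r := R)⟩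
  have hμ0 : μ ≠ 0 := by
    rw [hμ, Ne, Measure.restrict_eq_zero]
    exact (measure_ball_pos volume x hR).ne'
  have hm : AEMeasurable (fun z : ℂ × ℂ => ‖u z.1 - u z.2‖ₑ ^ q) (μ.prod μ) :=
    ((hum.comp_quasiMeasurePreserving Measure.quasiMeasurePreserving_fst).sub
      (hum.comp_quasiMeasurePreserving Measure.quasiMeasurePreserving_snd)).enorm.pow_const q
  have hdouble : ∫⁻ y, ∫⁻ z, ‖u z - u y‖ₑ ^ q ∂μ ∂μ ≤
      ediam (ball x R) ^ q * (4 * volume (ball x R) * ∫⁻ z, ‖H z‖ₑ ^ q ∂μ) := by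
    rw [← lintegral_prod_symm _ hm, hμ, Measure.prod_restrict, ← Measure.volume_eq_prod]
    exact hu.setLIntegral_prod_enorm_sub_rpow_ball_le hq
  obtain ⟨y, hy⟩ := exists_le_laverage hμ0 hm.prod_swap.lintegral_prod_right'
  refine ⟨u y, hy.trans ?_⟩
  rw [laverage_eq, hμ, Measure.restrict_apply_univ]
  exact ENNReal.div_le_of_le_mul (hdouble.trans_eq (by ring))

theorem HasWeakGradientOn.exists_rpow_setLIntegral_enorm_sub_const_ball_le
    (hu : HasWeakGradientOn (ball x R) u H) (hR : 0 < R) (hq : 1 ≤ q) :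
    ∃ c : ℝ, (∫⁻ z in ball x R, ‖u z - c‖ₑ ^ q) ^ (1 / q) ≤
      4 * ediam (ball x R) * gradNorm q (ball x R) H := by
  have hq0 : 0 < q := zero_lt_one.trans_le hq
  obtain ⟨c, hc⟩ := hu.exists_setLIntegral_enorm_sub_const_rpow_ball_le hR hq
  refine ⟨c, ?_⟩
  calc (∫⁻ z in ball x R, ‖u z - c‖ₑ ^ q) ^ (1 / q)
      ≤ (ediam (ball x R) ^ q * (4 ^ q * ∫⁻ z in ball x R, ‖H z‖ₑ ^ q)) ^ (1 / q) := by
        gcongr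
        refine hc.trans ?_
        gcongr
        exact ENNReal.le_rpow_self_of_one_le (by norm_num) hq
    _ = _ := by
        rw [← mul_assoc, ← ENNReal.mul_rpow_of_nonneg _ _ hq0.le,
          ENNReal.mul_rpow_of_nonneg _ _ (by positivity), ← ENNReal.rpow_mul,
          mul_one_div_cancel hq0.ne', ENNReal.rpow_one, gradNorm, mul_comm (ediam _)]

theorem MemHomSobolev.memSobolev_ball (hu : MemHomSobolev q (ball x R) u H) (hR : 0 < R)
    (hq : 1 ≤ q) : MemSobolev q (ball x R) u H := by
  have hq0 : 0 < q := zero_lt_one.trans_le hq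
  obtain ⟨c, hc⟩ := hu.1.exists_rpow_setLIntegral_enorm_sub_const_ball_le hR hq
  have : IsFiniteMeasure ((volume : Measure ℂ).restrict (ball x R)) :=
    ⟨by simpa using measure_ball_lt_top (μ := volume) (x := x) (r := R)⟩
  have hsub : MemLp (fun z => u z - c) (ENNReal.ofReal q) (volume.restrict (ball x R)) := by
    refine ⟨hu.1.1.aestronglyMeasurable.sub aestronglyMeasurable_const, ?_⟩
    rw [eLpNorm_eq_lintegral_rpow_enorm_toReal (by simpa using hq0) ENNReal.ofReal_ne_top,
      ENNReal.toReal_ofReal hq0.le]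
    exact hc.trans_lt (ENNReal.mul_lt_top
      (ENNReal.mul_lt_top (by norm_num) isBounded_ball.ediam_ne_top.lt_top)
      (hu.gradNorm_lt_top hq0))
  exact ⟨by simpa [Pi.add_def] using hsub.add (memLp_const c), hu⟩

theorem rpow_lintegral_add_const_mul_le {X : Type*} [MeasurableSpace X] {μ : Measure X}
    {f g : X → ℝ≥0∞} (hf : AEMeasurable f μ) (hg : AEMeasurable g μ) (a : ℝ≥0) (hq : 1 ≤ q) :
    (∫⁻ z, (f z + a * g z) ^ q ∂μ) ^ (1 / q) ≤
      (∫⁻ z, f z ^ q ∂μ) ^ (1 / q) + a * (∫⁻ z, g z ^ q ∂μ) ^ (1 / q) := by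
  have hq0 : 0 < q := zero_lt_one.trans_le hq
  refine (ENNReal.lintegral_Lp_add_le hf (hg.const_mul (a : ℝ≥0∞)) hq).trans_eq ?_
  simp_rw [ENNReal.mul_rpow_of_nonneg _ _ hq0.le]
  rw [lintegral_const_mul' _ _ (ENNReal.rpow_ne_top_of_nonneg hq0.le ENNReal.coe_ne_top),
    ENNReal.mul_rpow_of_nonneg _ _ (by positivity), ← ENNReal.rpow_mul,
    mul_one_div_cancel hq0.ne', ENNReal.rpow_one]

theorem exists_rpow_setLIntegral_critical_unitDisc_le :
    ∃ C : ℝ≥0, ∀ q ∈ Ico (1 : ℝ) 2, ∀ s : ℝ≥0, s = 2 * q / (2 - q) → ∀ (u : ℂ → ℝ) (H : ℂ → ℂ),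
      HasWeakGradientOn unitDisc u H → (∫⁻ z in unitDisc, ‖u z‖ₑ ^ (s : ℝ)) ^ (1 / s : ℝ) ≤
        C * ((∫⁻ z in unitDisc, ‖u z‖ₑ ^ q) ^ (1 / q) +
          (s / 2 : ℝ≥0) * gradNorm q unitDisc H) := by
  obtain ⟨C, hC⟩ := exists_rpow_setLIntegral_critical_ball_le
  refine ⟨C, fun q hq s hs u H hu => ?_⟩
  have hs0 : 0 < (s : ℝ) := by
    rw [hs]
    exact div_pos (by linarith [hq.1]) (sub_pos.2 hq.2)
  rw [one_div, ENNReal.rpow_inv_le_iff hs0]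
  refine setLIntegral_ball_le_of_forall_lt one_half_lt_one fun ρ hρ => ?_
  obtain ⟨U, hU, hUu, hUH, hlim⟩ := hu.exists_seq_contDiff_tendsto isOpen_ball measurableSet_ball
    isBounded_ball.isCompact_closure
    (closure_ball_subset_closedBall.trans (closedBall_subset_ball hρ.2)) hq.1
  refine lintegral_le_of_ae_tendsto (fun n => ?_)
    (hlim.mono fun z hz => (ENNReal.continuous_rpow_const.tendsto _).comp hz.enorm) fun n => ?_
  · exact ((hU n).continuous.enorm.measurable.pow_const _).aemeasurable
  · rw [← ENNReal.rpow_inv_le_iff hs0, ← one_div]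
    refine (hC ρ (Ioo_subset_Icc_self hρ) q hq s hs (U n) (hU n)).trans ?_
    gcongr
    refine (rpow_lintegral_add_const_mul_le (hU n).continuous.enorm.measurable.aemeasurable
      ((hU n).continuous_fderiv one_ne_zero).enorm.measurable.aemeasurable _ hq.1).trans ?_
    have hq' : 0 ≤ 1 / q := one_div_nonneg.2 (zero_le_one.trans hq.1)
    exact add_le_add (ENNReal.rpow_le_rpow (hUu n) hq')
      (mul_le_mul' le_rfl (ENNReal.rpow_le_rpow (hUH n) hq'))

end Ball

section SmoothFunctions

variable {Ω : Set ℂ}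

theorem continuous_gradient {g : ℂ → ℝ} (hg : ContDiff ℝ 1 g) : Continuous (gradient g) :=
  (InnerProductSpace.toDual ℝ ℂ).symm.continuous.comp (hg.continuous_fderiv one_ne_zero)

theorem hasWeakGradientOn_gradient {g : ℂ → ℝ} (hg : ContDiff ℝ 1 g) (Ω : Set ℂ) :
    HasWeakGradientOn Ω g (gradient g) := by
  refine ⟨hg.continuous.locallyIntegrable.locallyIntegrableOn _,
    (continuous_gradient hg).locallyIntegrable.locallyIntegrableOn _, fun η hη hηc hηs v => ?_⟩
  have hg' : Continuous fun z => fderiv ℝ g z v :=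
    (hg.continuous_fderiv one_ne_zero).clm_apply continuous_const
  have hη' : Continuous fun z => fderiv ℝ η z v :=
    (hη.continuous_fderiv (by simp)).clm_apply continuous_const
  simp_rw [inner_gradient_left]
  rw [setIntegral_eq_integral_of_forall_compl_eq_zero fun z hz => ?_,
    setIntegral_eq_integral_of_forall_compl_eq_zero fun z hz => ?_]
  · exact integral_mul_fderiv_eq_neg_fderiv_mul_of_integrable
      ((hg'.mul hη.continuous).integrable_of_hasCompactSupport hηc.mul_left)
      ((hg.continuous.mul hη').integrable_of_hasCompactSupport (hηc.fderiv_apply ℝ v).mul_left)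
      ((hg.continuous.mul hη.continuous).integrable_of_hasCompactSupport hηc.mul_left)
      (fun x _ => hg.differentiable one_ne_zero x) (fun x _ => hη.differentiable (by simp) x)
  · rw [image_eq_zero_of_notMem_tsupport fun h => hz (hηs h), mul_zero]
  · rw [image_eq_zero_of_notMem_tsupport
      fun h => hz (((tsupport_fderiv_apply_subset ℝ v).trans hηs) h), mul_zero]

theorem memSobolev_gradient {g : ℂ → ℝ} (hg : ContDiff ℝ 1 g) (hc : HasCompactSupport g)
    (p : ℝ) (Ω : Set ℂ) : MemSobolev p Ω g (gradient g) := by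
  refine ⟨(hg.continuous.memLp_of_hasCompactSupport hc).restrict Ω,
    hasWeakGradientOn_gradient hg Ω, ?_⟩
  have hc' : HasCompactSupport (gradient g) :=
    (hc.fderiv ℝ).comp_left (map_zero (InnerProductSpace.toDual ℝ ℂ).symm)
  exact ((continuous_gradient hg).memLp_of_hasCompactSupport hc').restrict Ω

theorem HasWeakGradientOn.sub_const {u : ℂ → ℝ} {H : ℂ → ℂ} (hu : HasWeakGradientOn Ω u H)
    (c : ℝ) : HasWeakGradientOn Ω (fun z => u z - c) H := by
  have hconst : HasWeakGradientOn Ω (fun _ => c) (gradient fun _ => c) :=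
    hasWeakGradientOn_gradient contDiff_const Ω
  refine ⟨hu.1.sub hconst.1, hu.2.1, fun η hη hηc hηs v => ?_⟩
  have hη' : Continuous fun z => fderiv ℝ η z v :=
    (hη.continuous_fderiv (by simp)).clm_apply continuous_const
  have hint {f : ℂ → ℝ} (hf : LocallyIntegrableOn f Ω) :
      IntegrableOn (fun z => f z * fderiv ℝ η z v) Ω :=
    (integrable_mul_of_tsupport_subset hf hη' (hηc.fderiv_apply ℝ v)
      ((tsupport_fderiv_apply_subset ℝ v).trans hηs)).integrableOn
  have hzero : ∫ z in Ω, c * fderiv ℝ η z v = 0 := by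
    simpa [gradient_fun_const'] using hconst.2.2 η hη hηc hηs v
  simp_rw [sub_mul]
  rw [integral_sub (hint hu.1) (hint hconst.1), hzero, sub_zero]
  exact hu.2.2 η hη hηc hηs v

end SmoothFunctions

section PoincareConst

open Metric
open scoped NNReal

variable {Ω : Set ℂ} {h : ℂ → ℝ} {p q r : ℝ}

theorem infDistConst_ne_zero (hr : 0 < r) (hh : Measurable h) (hpos : ∀ z ∈ Ω, 0 < h z)
    {A B : Set ℂ} (hA : IsOpen A) (hB : IsOpen B) (hA₀ : A.Nonempty) (hB₀ : B.Nonempty)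
    (hAΩ : A ⊆ Ω) (hBΩ : B ⊆ Ω) {f : ℂ → ℝ} {a b : ℝ} (hfA : ∀ z ∈ A, f z = a)
    (hfB : ∀ z ∈ B, f z = b) (hab : a ≠ b) : infDistConst r Ω h f ≠ 0 := by
  have hmass {S : Set ℂ} (hS : IsOpen S) (hS₀ : S.Nonempty) (hSΩ : S ⊆ Ω) :
      0 < ∫⁻ z in S, ENNReal.ofReal (h z) := by
    rw [setLIntegral_pos_iff hh.ennreal_ofReal]
    refine (hS.measure_pos _ hS₀).trans_le (measure_mono fun z hz => ⟨?_, hz⟩)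
    exact (ENNReal.ofReal_pos.2 (hpos z (hSΩ hz))).ne'
  have hle {S : Set ℂ} (hS : IsOpen S) (hSΩ : S ⊆ Ω) {s : ℝ} (hs : ∀ z ∈ S, f z = s) (c : ℝ) :
      ‖s - c‖ₑ ^ r * ∫⁻ z in S, ENNReal.ofReal (h z) ≤
        ∫⁻ z in Ω, ‖f z - c‖ₑ ^ r * ENNReal.ofReal (h z) := by
    rw [← lintegral_const_mul _ hh.ennreal_ofReal]
    refine le_trans ?_ (lintegral_mono_set hSΩ)
    exact setLIntegral_mono' hS.measurableSet fun z hz => by rw [hs z hz]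
  set δ := ‖a - b‖ₑ / 2
  have hδ : 0 < δ := ENNReal.half_pos (by simpa [sub_eq_zero] using hab)
  have hfar (c : ℝ) : δ ≤ ‖a - c‖ₑ ∨ δ ≤ ‖b - c‖ₑ := by
    by_contra! hnear
    refine absurd ((enorm_sub_le (a := a - c) (b := b - c)).trans_lt
      (ENNReal.add_lt_add hnear.1 hnear.2)) ?_
    rw [ENNReal.add_halves, sub_sub_sub_cancel_right]
    exact lt_irrefl _
  have hm : 0 < δ ^ r * min (∫⁻ z in A, ENNReal.ofReal (h z)) (∫⁻ z in B, ENNReal.ofReal (h z)) :=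
    ENNReal.mul_pos (ENNReal.rpow_pos_of_nonneg hδ hr.le).ne'
      (lt_min (hmass hA hA₀ hAΩ) (hmass hB hB₀ hBΩ)).ne'
  refine ((ENNReal.rpow_pos_of_nonneg hm (one_div_nonneg.2 hr.le)).trans_le
    (le_iInf fun c => ENNReal.rpow_le_rpow ?_ (one_div_nonneg.2 hr.le))).ne'
  obtain hc | hc := hfar c
  · exact (mul_le_mul' (ENNReal.rpow_le_rpow hc hr.le) (min_le_left _ _)).trans (hle hA hAΩ hfA c)
  · exact (mul_le_mul' (ENNReal.rpow_le_rpow hc hr.le) (min_le_right _ _)).trans (hle hB hBΩ hfB c)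

theorem exists_memSobolev_infDistConst_ne_zero (hΩ : IsOpen Ω) (hΩ₀ : Ω.Nonempty) (hr : 0 < r)
    (hh : Measurable h) (hpos : ∀ z ∈ Ω, 0 < h z) (p : ℝ) :
    ∃ f G, MemSobolev p Ω f G ∧ infDistConst r Ω h f ≠ 0 := by
  obtain ⟨z₀, hz₀⟩ := hΩ₀
  obtain ⟨R, hR, hball⟩ := isOpen_iff.1 hΩ z₀ hz₀
  let b : ContDiffBump z₀ := ⟨R / 4, R / 2, by positivity, by linarith⟩
  have hR4 : dist (z₀ + (3 / 4 * R : ℝ)) z₀ = 3 / 4 * R := by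
    rw [dist_eq_norm, add_sub_cancel_left, Complex.norm_real, Real.norm_of_nonneg (by positivity)]
  refine ⟨b, _, memSobolev_gradient b.contDiff b.hasCompactSupport p Ω,
    infDistConst_ne_zero hr hh hpos (A := ball z₀ (R / 4)) (B := ball z₀ R \ closedBall z₀ (R / 2))
      isOpen_ball (isOpen_ball.sdiff isClosed_closedBall) (nonempty_ball.2 (by positivity))
      ⟨z₀ + (3 / 4 * R : ℝ), ?_, ?_⟩ ((ball_subset_ball (by linarith)).trans hball)
      (sdiff_subset.trans hball) (fun z hz => b.one_of_mem_closedBall (ball_subset_closedBall hz))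
      (fun z hz => b.zero_of_le_dist (not_le.1 hz.2).le) one_ne_zero⟩
  · rw [mem_ball, hR4]
    linarith
  · rw [mem_closedBall, hR4]
    linarith

theorem infDistConst_le_poincareConst_mul (hp : 0 < p) (hfin : poincareConst r p Ω h < ⊤)
    {f : ℂ → ℝ} {G : ℂ → ℂ} (hf : MemSobolev p Ω f G) :
    infDistConst r Ω h f ≤ poincareConst r p Ω h * gradNorm p Ω G := by
  obtain ⟨C, hC, -⟩ := sInf_lt_iff.1 hfin
  rw [poincareConst, sInf_eq_iInf', ENNReal.iInf_mul'
    (fun htop => absurd htop (hf.2.gradNorm_lt_top hp).ne) fun _ => ⟨⟨C, hC⟩⟩]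
  exact le_iInf fun C => C.2 f G hf

theorem poincareConst_ne_zero (hΩ : IsOpen Ω) (hΩ₀ : Ω.Nonempty) (hr : 0 < r) (hp : 0 < p)
    (hh : Measurable h) (hpos : ∀ z ∈ Ω, 0 < h z) : poincareConst r p Ω h ≠ 0 := by
  intro hzero
  obtain ⟨f, G, hf, hne⟩ := exists_memSobolev_infDistConst_ne_zero hΩ hΩ₀ hr hh hpos p
  have hle := infDistConst_le_poincareConst_mul hp (hzero.trans_lt ENNReal.zero_lt_top) hf
  rw [hzero, zero_mul] at hle
  exact hne (nonpos_iff_eq_zero.1 hle)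

theorem poincareConst_unitDisc_lt_top (hq : q ∈ Ico 1 2) (hr : 0 < r)
    (hrq : r ≤ 2 * q / (2 - q)) : poincareConst r q unitDisc (fun _ => 1) < ⊤ := by
  lift 2 * q / (2 - q) to ℝ≥0 using hr.le.trans hrq with s hs
  obtain ⟨C, hC⟩ := exists_rpow_setLIntegral_critical_unitDisc_le
  set A := volume unitDisc ^ (1 / r - 1 / s : ℝ)
  have hA : A < ⊤ := ENNReal.rpow_lt_top_of_nonneg
    (sub_nonneg.2 (one_div_le_one_div_of_le hr hrq)) (measure_ball_lt_top (x := (0 : ℂ))).ne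
  refine lt_of_le_of_lt (b := C * (4 * ediam unitDisc + (s / 2 : ℝ≥0)) * A)
    (sInf_le fun f G hf => ?_)
    (ENNReal.mul_lt_top (ENNReal.mul_lt_top ENNReal.coe_lt_top (ENNReal.add_lt_top.2
      ⟨ENNReal.mul_lt_top (by norm_num) isBounded_ball.ediam_ne_top.lt_top,
        ENNReal.coe_lt_top⟩)) hA)
  obtain ⟨c, hc⟩ := hf.2.1.exists_rpow_setLIntegral_enorm_sub_const_ball_le one_pos hq.1
  have hcrit := hC q hq s hs _ G (hf.2.1.sub_const c)
  have hHolder := eLpNorm'_le_eLpNorm'_mul_rpow_measure_univ hr hrq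
    (hf.2.1.sub_const c).1.aestronglyMeasurable
  rw [Measure.restrict_apply_univ] at hHolder
  refine (iInf_le _ c).trans ?_
  simp only [ENNReal.ofReal_one, mul_one]
  calc (∫⁻ z in unitDisc, ‖f z - c‖ₑ ^ r) ^ (1 / r)
      ≤ (∫⁻ z in unitDisc, ‖f z - c‖ₑ ^ (s : ℝ)) ^ (1 / s : ℝ) * A := hHolder
    _ ≤ C * (4 * ediam unitDisc * gradNorm q unitDisc G +
          (s / 2 : ℝ≥0) * gradNorm q unitDisc G) * A := by
        gcongr
        exact hcrit.trans (by gcongr; exact hc)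
    _ = _ := by ring

end PoincareConst

section Transfer

variable {Ω : Set ℂ} {φ : ℂ → ℂ} {p q r : ℝ}

theorem poincareConst_conformalWeight_le_of_ne_top (hΩ : IsOpen Ω)
    (h : IsConformalHomeo Ω unitDisc φ) (hq : 1 ≤ q) (hr : 0 < r)
    (hB : poincareConst r q unitDisc (fun _ => 1) ≠ ⊤) :
    poincareConst r p Ω (conformalWeight φ) ≤
      compositionNorm p q Ω unitDisc (Function.invFunOn φ Ω) *
        poincareConst r q unitDisc (fun _ => 1) := by
  have hq0 : 0 < q := zero_lt_one.trans_le hq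
  have hB0 : poincareConst r q unitDisc (fun _ => 1) ≠ 0 :=
    poincareConst_ne_zero Metric.isOpen_ball (Metric.nonempty_ball.2 one_pos) hr hq0
      measurable_const fun _ _ => one_pos
  rw [compositionNorm, sInf_eq_iInf', ENNReal.iInf_mul_of_ne hB0 hB]
  refine le_iInf fun ⟨K, _, hK⟩ => sInf_le fun f G hf => ?_
  obtain ⟨H, hH, hHle⟩ := hK f G hf.2
  calc infDistConst r Ω (conformalWeight φ) f
      = infDistConst r unitDisc (fun _ => 1) (f ∘ Function.invFunOn φ Ω) :=
        (infDistConst_comp_leftInvOn h hΩ h.2.injOn.leftInvOn_invFunOn r f).symm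
    _ ≤ poincareConst r q unitDisc (fun _ => 1) * gradNorm q unitDisc H :=
        infDistConst_le_poincareConst_mul hq0 hB.lt_top (hH.memSobolev_ball one_pos hq)
    _ ≤ poincareConst r q unitDisc (fun _ => 1) * (K * gradNorm p Ω G) := by gcongr
    _ = K * poincareConst r q unitDisc (fun _ => 1) * gradNorm p Ω G := by ring

theorem compositionNorm_invFunOn_ne_zero (hΩ : IsOpen Ω) (h : IsConformalHomeo Ω unitDisc φ)
    (hp : 0 < p) (hq : q ∈ Ico 1 2) :
    compositionNorm p q Ω unitDisc (Function.invFunOn φ Ω) ≠ 0 := by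
  have hq0 : 0 < q := zero_lt_one.trans_le hq.1
  have hqq : q ≤ 2 * q / (2 - q) := by
    rw [le_div_iff₀ (sub_pos.2 hq.2)]
    nlinarith
  have hΩ₀ : Ω.Nonempty :=
    (h.2.image_eq ▸ Metric.nonempty_ball.2 one_pos : (φ '' Ω).Nonempty).of_image
  have hweight : ∀ z ∈ Ω, 0 < conformalWeight φ z := fun z hz =>
    pow_pos (norm_pos_iff.2 (h.deriv_ne_zero hΩ hz)) 2
  intro hzero
  have hle := poincareConst_conformalWeight_le_of_ne_top (p := p) hΩ h hq.1 hq0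
    (poincareConst_unitDisc_lt_top hq hq0 hqq).ne
  rw [hzero, zero_mul] at hle
  exact poincareConst_ne_zero hΩ hΩ₀ hq0 hp ((measurable_deriv φ).norm.pow_const 2) hweight
    (nonpos_iff_eq_zero.1 hle)

theorem poincareConst_conformalWeight_le (hΩ : IsOpen Ω) (h : IsConformalHomeo Ω unitDisc φ)
    (hp : 0 < p) (hq : q ∈ Ico 1 2) (hr : 0 < r) :
    poincareConst r p Ω (conformalWeight φ) ≤
      compositionNorm p q Ω unitDisc (Function.invFunOn φ Ω) *
        poincareConst r q unitDisc (fun _ => 1) := by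
  by_cases hB : poincareConst r q unitDisc (fun _ => 1) = ⊤
  · rw [hB, ENNReal.mul_top (compositionNorm_invFunOn_ne_zero hΩ h hp hq)]
    exact le_top
  · exact poincareConst_conformalWeight_le_of_ne_top hΩ h hq.1 hr hB

theorem exists_exponent_eq {a : ℝ} (ha : a ∈ Ioo 0 2) (hp : p ∈ Ico ((a + 2) / (a + 1)) 2) :
    ∃ q ∈ Ico 1 (2 * p / (4 - p)),
      (p - 2) * q / (p - q) = -a ∧ 2 * q / (2 - q) = 2 * p / (2 - p) * (a / (2 + a)) := by
  obtain ⟨ha0, ha2⟩ := ha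
  have hpa : a + 2 ≤ p * (a + 1) := (div_le_iff₀ (by linarith)).1 hp.1
  have hp1 : 1 < p := by nlinarith
  have hp2 : 0 < 2 - p := sub_pos.2 hp.2
  have hd : 0 < 2 + a - p := by linarith
  refine ⟨a * p / (2 + a - p), ⟨(one_le_div hd).2 (by linarith), ?_⟩, ?_, ?_⟩
  · rw [div_lt_div_iff₀ hd (by linarith)]
    nlinarith [mul_pos (mul_pos hp2 (sub_pos.2 ha2)) (zero_lt_one.trans hp1)]
  · have hsub : p - a * p / (2 + a - p) = p * (2 - p) / (2 + a - p) := by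
      field_simp
      ring
    rw [hsub]
    field_simp
    ring
  · have hsub : 2 - a * p / (2 + a - p) = (2 - p) * (2 + a) / (2 + a - p) := by
      field_simp
      ring
    rw [hsub]
    field_simp

end Transfer

theorem theoremC_general {Ω : Set ℂ} (hΩ : IsOpen Ω) {φ : ℂ → ℂ}
    (hφ : IsConformalHomeo Ω unitDisc φ) {α p r : ℝ} (hα : α ∈ Ioo (-2 : ℝ) 0)
    (hint : ∫⁻ w in unitDisc, ‖deriv (Function.invFunOn φ Ω) w‖ₑ ^ α < ⊤)
    (hp : p ∈ Ico ((|α| + 2) / (|α| + 1)) 2)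
    (hr : r ∈ Ioc 0 (2 * p / (2 - p) * (|α| / (2 + |α|)))) :
    poincareConst r p Ω (conformalWeight φ) < ⊤ ∧
    (∀ (f : ℂ → ℝ) (G : ℂ → ℂ), MemSobolev p Ω f G →
      infDistConst r Ω (conformalWeight φ) f ≤
        poincareConst r p Ω (conformalWeight φ) * gradNorm p Ω G) ∧
    poincareConst r p Ω (conformalWeight φ) ≤
      ⨅ q ∈ Ico 1 (2 * p / (4 - p)),
        compositionNorm p q Ω unitDisc (Function.invFunOn φ Ω) *
          poincareConst r q unitDisc (fun _ => 1) ∧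
    (⨅ q ∈ Ico 1 (2 * p / (4 - p)),
        compositionNorm p q Ω unitDisc (Function.invFunOn φ Ω) *
          poincareConst r q unitDisc (fun _ => 1)) < ⊤ ∧
    (∀ q ∈ Ico 1 (2 * p / (4 - p)),
      compositionNorm p q Ω unitDisc (Function.invFunOn φ Ω) ≤
        (∫⁻ w in unitDisc, ‖deriv (Function.invFunOn φ Ω) w‖ₑ ^ ((p - 2) * q / (p - q))) ^
          ((p - q) / (p * q))) := by
  obtain ⟨q₀, hq₀, hexp, hcrit⟩ := exists_exponent_eq (a := |α|)
    ⟨abs_pos.2 hα.2.ne, abs_lt.2 ⟨hα.1, hα.2.trans two_pos⟩⟩ hp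
  have hp0 : 0 < p := lt_of_lt_of_le (by positivity) hp.1
  have hq_lt (q : ℝ) (hq : q ∈ Ico 1 (2 * p / (4 - p))) : q < p ∧ q < 2 := by
    have hq4 : q * (4 - p) < 2 * p := (lt_div_iff₀ (by linarith [hp.2])).1 hq.2
    constructor <;> nlinarith [hp.2]
  have hK (q : ℝ) (hq : q ∈ Ico 1 (2 * p / (4 - p))) :=
    compositionNorm_le (hφ.invFunOn hΩ) (hφ.isOpen_target hΩ) (zero_lt_one.trans_le hq.1)
      (hq_lt q hq).1
  have hKfin : compositionNorm p q₀ Ω unitDisc (Function.invFunOn φ Ω) < ⊤ :=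
    compositionNorm_lt_top (hφ.invFunOn hΩ) (hφ.isOpen_target hΩ) (zero_lt_one.trans_le hq₀.1)
      (hq_lt q₀ hq₀).1 (by rwa [hexp, abs_of_neg hα.2, neg_neg])
  have hBfin : poincareConst r q₀ unitDisc (fun _ => 1) < ⊤ :=
    poincareConst_unitDisc_lt_top ⟨hq₀.1, (hq_lt q₀ hq₀).2⟩ hr.1 (hr.2.trans_eq hcrit.symm)
  have hle := le_iInf₂ fun q hq =>
    poincareConst_conformalWeight_le hΩ hφ hp0 ⟨hq.1, (hq_lt q hq).2⟩ hr.1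
  have hfin := lt_of_le_of_lt (iInf₂_le (f := fun q _ =>
    compositionNorm p q Ω unitDisc (Function.invFunOn φ Ω) *
      poincareConst r q unitDisc (fun _ => 1)) q₀ hq₀) (ENNReal.mul_lt_top hKfin hBfin)
  exact ⟨hle.trans_lt hfin, fun f G => infDistConst_le_poincareConst_mul hp0 (hle.trans_lt hfin),
    hle, hfin, hK⟩

theorem theoremC (Ω : Set ℂ) (hΩ_open : IsOpen Ω) (hΩ_sc : IsSimplyConnected Ω)
    (hΩ_bdry : (frontier Ω).Nonempty)
    (α₀ : ℝ) (hα₀ : α₀ ∈ Ioo (-2 : ℝ) 0) (hBrennan : BrennanConjectureOn α₀)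
    (φ : ℂ → ℂ) (hφ : IsConformalHomeo Ω unitDisc φ)
    (p : ℝ) (hp : p ∈ Ioo ((|α₀| + 2) / (|α₀| + 1)) 2)
    (r : ℝ) (hr : r ∈ Icc 1 (2 * p / (2 - p) * (|α₀| / (2 + |α₀|)))) :
    -- the inequality holds, with the best constant, which is finite
    poincareConst r p Ω (conformalWeight φ) < ⊤ ∧
    (∀ (f : ℂ → ℝ) (G : ℂ → ℂ), MemSobolev p Ω f G →
      infDistConst r Ω (conformalWeight φ) f ≤
        poincareConst r p Ω (conformalWeight φ) * gradNorm p Ω G) ∧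
    -- the estimate of the best constant, with a finite right-hand side
    poincareConst r p Ω (conformalWeight φ) ≤
      ⨅ q ∈ Ico 1 (2 * p / (4 - p)),
        compositionNorm p q Ω unitDisc (Function.invFunOn φ Ω) *
          poincareConst r q unitDisc (fun _ => 1) ∧
    (⨅ q ∈ Ico 1 (2 * p / (4 - p)),
        compositionNorm p q Ω unitDisc (Function.invFunOn φ Ω) *
          poincareConst r q unitDisc (fun _ => 1)) < ⊤ ∧
    -- the estimate of the norm of the composition operator
    (∀ q ∈ Ico 1 (2 * p / (4 - p)),
      compositionNorm p q Ω unitDisc (Function.invFunOn φ Ω) ≤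
        (∫⁻ w in unitDisc, ‖deriv (Function.invFunOn φ Ω) w‖ₑ ^ ((p - 2) * q / (p - q))) ^
          ((p - q) / (p * q))) := by
  exact theoremC_general hΩ_open hφ hα₀ (hBrennan _ _ (hφ.invFunOn hΩ_open) α₀
    ⟨le_rfl, by linarith [hα₀.2]⟩) (Ioo_subset_Ico_self hp) ⟨zero_lt_one.trans_le hr.1, hr.2⟩
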